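/- Let $\Omega\subset\mathbb C$ be a Borel set, $\lambda$ Lebesgue measure, and let $\mathcal B(L^2(\Omega,\lambda))$ be the algebra of bounded operators on $L^2(\Omega,\lambda)$. Write $|A|_2=(\operatorname{Tr}A^*A)^{1/2}\in[0,\infty]$ for the Hilbert--Schmidt norm and $M_f$ for multiplication by $f\in L^\infty(\Omega,\lambda)$ on $L^2(\Omega,\lambda)$. Put $Df(s,t)=\frac{f(s)-f(t)}{s-t}$ for $s\neq t$, let $\Lambda(\Omega)$ be the set of all $f\in L^\infty(\Omega,\lambda)$ with $Df\in L^\infty(\Omega\times\Omega,\lambda\otimes\lambda)$, and for $T\in\mathcal B(L^2(\Omega,\lambda))$ let $$L(T)=\sup\{|[M_f,T]|_2 : f\in\Lambda(\Omega),\ \|Df\|_\infty\le 1\}\in[0,\infty].$$ Let $E\Lambda(\Omega)$ be the subalgebra $\{T\in\mathcal B(L^2(\Omega,\lambda)) : L(T)<\infty\}$, with the norm $|||T|||=\|T\|+L(T)$. For $w\in\mathbb C$ let $U(w)$ be multiplication by the function $z\mapsto\exp(i\operatorname{Re}(z\overline w))$ on $L^2(\Omega,\lambda)$, and let $$L_1(T)=\sup\{|w|^{-1}\,|[T,U(w)]|_2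 : w\in\mathbb C\setminus\{0\}\}\in[0,\infty].$$ (1) For every $T\in\mathcal B(L^2(\Omega,\lambda))$ we have $L_1(T)\le L(T)\le 2L_1(T)$. (2) $|||T|||_1=\|T\|+L_1(T)$ is a Banach algebra norm on $E\Lambda(\Omega)$ (a submultiplicative norm of complex vector spaces for which $E\Lambda(\Omega)$ is complete), and it is equivalent to the norm $|||\cdot|||$. (3) If $\Omega$ is bounded and $Z$ denotes multiplication by the coordinate function $z$ on $L^2(\Omega,\lambda)$, then $L(T)=|[T,Z]|_2$ for every $T\in\mathcal B(L^2(\Omega,\lambda))$ (both sides may be $+\infty$). -/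

import Mathlib

open MeasureTheory
open scoped ENNReal ComplexConjugate

namespace ELam

noncomputable section

/-! ### The Hilbert–Schmidt norm -/

section HilbertSchmidt

variable {H : Type*} [NormedAddCommGroup H] [InnerProductSpace ℂ H]

theorem parseval {ι : Type*} (b : HilbertBasis ι ℂ H) (x : H) :
    ∑' i, ‖inner ℂ (b i) x‖ₑ ^ 2 = ‖x‖ₑ ^ 2 := by
  have h := (b.hasSum_inner_mul_inner x x).mapL Complex.reCLM
  have h2 : HasSum (fun i => ‖inner ℂ (b i) x‖ ^ 2) (‖x‖ ^ 2) := by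
    convert! h using 1
    · funext i
      have : (inner ℂ x (b i) : ℂ) = conj (inner ℂ (b i) x : ℂ) := (inner_conj_symm _ _).symm
      rw [this, mul_comm, Complex.mul_conj, Complex.normSq_eq_norm_sq]
      simp only [Complex.reCLM_apply, Complex.ofReal_re]
    · rw [inner_self_eq_norm_sq_to_K]
      norm_cast
  have h3 := ENNReal.ofReal_tsum_of_nonneg (f := fun i => ‖inner ℂ (b i) x‖ ^ 2)
    (fun i => by positivity) h2.summable
  rw [h2.tsum_eq] at h3
  simp only [ENNReal.ofReal_pow (norm_nonneg _), ofReal_norm] at h3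
  exact h3.symm

variable [CompleteSpace H]

variable (H) in
/-- The index set of a chosen orthonormal basis of a complex Hilbert space. -/
def basisIndex : Set H := (exists_hilbertBasis ℂ H).choose

variable (H) in
/-- A chosen orthonormal basis of a complex Hilbert space. -/
def basis : HilbertBasis (basisIndex H) ℂ H := (exists_hilbertBasis ℂ H).choose_spec.choose

/-- The Hilbert–Schmidt norm `|A|₂ = Tr(A* A)^{1/2} = (∑ i, ‖A eᵢ‖²)^{1/2}` with values in
`[0, ∞]`; it is finite exactly on the Hilbert–Schmidt operators. It does not depend on the
orthonormal basis, see `hsNorm_eq`. -/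
def hsNorm (A : H →L[ℂ] H) : ℝ≥0∞ :=
  (∑' i, ‖A (basis H i)‖ₑ ^ 2) ^ (1 / 2 : ℝ)

theorem tsum_adjoint {ι κ : Type*} (b : HilbertBasis ι ℂ H) (c : HilbertBasis κ ℂ H)
    (A : H →L[ℂ] H) :
    ∑' i, ‖A (b i)‖ₑ ^ 2 = ∑' j, ‖ContinuousLinearMap.adjoint A (c j)‖ₑ ^ 2 := by
  simp_rw [← parseval c (A _), ← parseval b (ContinuousLinearMap.adjoint A _)]
  rw [ENNReal.tsum_comm]
  refine tsum_congr fun j => tsum_congr fun i => ?_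
  rw [ContinuousLinearMap.adjoint_inner_right, ← inner_conj_symm, RCLike.enorm_conj]

theorem hsNorm_eq {ι : Type*} (b : HilbertBasis ι ℂ H) (A : H →L[ℂ] H) :
    hsNorm A = (∑' i, ‖A (b i)‖ₑ ^ 2) ^ (1 / 2 : ℝ) := by
  rw [hsNorm, tsum_adjoint (basis H) (basis H) A, tsum_adjoint b (basis H) A]

theorem hsNorm_adjoint (A : H →L[ℂ] H) : hsNorm (ContinuousLinearMap.adjoint A) = hsNorm A := by
  rw [hsNorm, hsNorm, ← tsum_adjoint (basis H) (basis H) A]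

theorem hsNorm_mul_le (A B : H →L[ℂ] H) : hsNorm (A * B) ≤ ‖A‖ₑ * hsNorm B := by
  have h : ‖A‖ₑ = (‖A‖ₑ ^ 2) ^ (1 / 2 : ℝ) := by
    rw [← ENNReal.rpow_natCast, ← ENNReal.rpow_mul]; norm_num
  rw [hsNorm, hsNorm, h, ← ENNReal.mul_rpow_of_nonneg _ _ (by norm_num), ← ENNReal.tsum_mul_left]
  gcongr with i
  rw [← mul_pow]
  gcongr
  exact A.le_opENorm _

theorem hsNorm_mul_le' (A B : H →L[ℂ] H) : hsNorm (A * B) ≤ hsNorm A * ‖B‖ₑ := by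
  rw [← hsNorm_adjoint (A * B), ← hsNorm_adjoint A, mul_comm]
  have h : ContinuousLinearMap.adjoint (A * B)
      = ContinuousLinearMap.adjoint B * ContinuousLinearMap.adjoint A :=
    ContinuousLinearMap.adjoint_comp A B
  have h2 : ‖B‖ₑ = ‖ContinuousLinearMap.adjoint B‖ₑ := by
    rw [← ofReal_norm, ← ofReal_norm, LinearIsometryEquiv.norm_map]
  rw [h, h2]
  exact hsNorm_mul_le _ _

theorem hsNorm_add_le (A B : H →L[ℂ] H) : hsNorm (A + B) ≤ 2 * (hsNorm A + hsNorm B) := by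
  have key : ∀ a b : ℝ≥0∞, (a + b) ^ 2 ≤ 4 * (a ^ 2 + b ^ 2) := by
    intro a b
    rcases le_total a b with h | h
    · calc (a + b) ^ 2 ≤ (b + b) ^ 2 := by gcongr
        _ = 4 * b ^ 2 := by ring
        _ ≤ _ := by gcongr; exact le_add_self
    · calc (a + b) ^ 2 ≤ (a + a) ^ 2 := by gcongr
        _ = 4 * a ^ 2 := by ring
        _ ≤ _ := by gcongr; exact le_self_add
  have h4 : (4 : ℝ≥0∞) ^ (1 / 2 : ℝ) = 2 := by
    have : (4 : ℝ≥0∞) = 2 ^ (2 : ℝ) := by norm_num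
    rw [this, ← ENNReal.rpow_mul]; norm_num
  calc hsNorm (A + B)
      ≤ (4 * (∑' i, ‖A (basis H i)‖ₑ ^ 2 + ∑' i, ‖B (basis H i)‖ₑ ^ 2)) ^ (1 / 2 : ℝ) := by
        rw [hsNorm, ← ENNReal.tsum_add, ← ENNReal.tsum_mul_left]
        gcongr with i
        refine le_trans ?_ (key _ _)
        gcongr
        exact enorm_add_le _ _
    _ ≤ _ := by
        rw [ENNReal.mul_rpow_of_nonneg _ _ (by norm_num), h4]
        gcongr
        exact ENNReal.rpow_add_le_add_rpow _ _ (by norm_num) (by norm_num)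

end HilbertSchmidt

/-! ### Essentially Lipschitz functions and multiplication operators -/

/-- Lebesgue measure `λ` on a subset `Ω` of the complex plane. -/
abbrev leb (Ω : Set ℂ) : Measure ℂ := volume.restrict Ω

/-- The Hilbert space `L²(Ω, λ)`. -/
abbrev L2 (Ω : Set ℂ) : Type := Lp ℂ 2 (leb Ω)

/-- The algebra `B(L²(Ω, λ))` of bounded operators. -/
abbrev Op (Ω : Set ℂ) : Type := L2 Ω →L[ℂ] L2 Ω

/-- The space `L^∞(Ω, λ)` of complex-valued functions. -/
abbrev LInf (Ω : Set ℂ) : Type := Lp ℂ ∞ (leb Ω)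

/-- The operator of multiplication by `f ∈ L^∞(Ω, λ)` on `L²(Ω, λ)`. -/
def mulOp {Ω : Set ℂ} (f : LInf Ω) : Op Ω :=
  (ContinuousLinearMap.mul ℂ ℂ).holderL (leb Ω) ∞ 2 2 f

theorem mulOp_coeFn {Ω : Set ℂ} (f : LInf Ω) (h : L2 Ω) :
    mulOp f h =ᵐ[leb Ω] fun z => f z * h z :=
  ContinuousLinearMap.coeFn_holder _ _ _

/-- The difference quotient `Df(s,t) = (f(s) - f(t)) / (s - t)`, `s ≠ t`. (The diagonal is a null
set; there the value is `0`.) -/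
def diffQuot (f : ℂ → ℂ) (p : ℂ × ℂ) : ℂ := (f p.1 - f p.2) / (p.1 - p.2)

/-- The `L^∞(Ω × Ω, λ ⊗ λ)`-norm of the difference quotient of `f`. -/
def lipNorm {Ω : Set ℂ} (f : LInf Ω) : ℝ≥0∞ :=
  eLpNorm (diffQuot f) ∞ ((leb Ω).prod (leb Ω))

/-- The set `Λ(Ω)` of essentially Lipschitz functions in `L^∞(Ω, λ)`. -/
def Lam (Ω : Set ℂ) : Set (LInf Ω) :=
  {f | MemLp (diffQuot f) ∞ ((leb Ω).prod (leb Ω))}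

/-! ### The seminorm `L` and the algebra `EΛ(Ω)` -/

/-- `L(T) = sup {|[M_f, T]|₂ : f ∈ Λ(Ω), ‖Df‖_∞ ≤ 1}`, with values in `[0, ∞]`. -/
def L {Ω : Set ℂ} (T : Op Ω) : ℝ≥0∞ :=
  ⨆ f ∈ Lam Ω, ⨆ _ : lipNorm f ≤ 1, hsNorm (mulOp f * T - T * mulOp f)

theorem le_L {Ω : Set ℂ} (T : Op Ω) {f : LInf Ω} (hf : f ∈ Lam Ω) (h : lipNorm f ≤ 1) :
    hsNorm (mulOp f * T - T * mulOp f) ≤ L T :=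
  le_iSup₂_of_le f hf (le_iSup_of_le h le_rfl)

theorem mulOp_smul_comm {Ω : Set ℂ} (f : LInf Ω) (c : ℂ) :
    mulOp f * algebraMap ℂ (Op Ω) c - algebraMap ℂ (Op Ω) c * mulOp f = 0 := by
  rw [Algebra.commutes c (mulOp f), sub_self]

theorem L_algebraMap {Ω : Set ℂ} (c : ℂ) : L (algebraMap ℂ (Op Ω) c) = 0 := by
  simp [L, mulOp_smul_comm, hsNorm]

theorem L_add_le {Ω : Set ℂ} (S T : Op Ω) : L (S + T) ≤ 2 * (L S + L T) := by
  refine iSup₂_le fun f hf => iSup_le fun h => ?_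
  have e : mulOp f * (S + T) - (S + T) * mulOp f
      = (mulOp f * S - S * mulOp f) + (mulOp f * T - T * mulOp f) := by noncomm_ring
  rw [e]
  refine (hsNorm_add_le _ _).trans ?_
  gcongr
  · exact le_L S hf h
  · exact le_L T hf h

theorem L_mul_le {Ω : Set ℂ} (S T : Op Ω) : L (S * T) ≤ 2 * (L S * ‖T‖ₑ + ‖S‖ₑ * L T) := by
  refine iSup₂_le fun f hf => iSup_le fun h => ?_
  have e : mulOp f * (S * T) - (S * T) * mulOp f
      = (mulOp f * S - S * mulOp f) * T + S * (mulOp f * T - T * mulOp f) := by noncomm_ring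
  rw [e]
  refine (hsNorm_add_le _ _).trans ?_
  gcongr
  · exact (hsNorm_mul_le' _ _).trans (by gcongr; exact le_L S hf h)
  · exact (hsNorm_mul_le _ _).trans (by gcongr; exact le_L T hf h)

/-- The algebra `EΛ(Ω) = {T ∈ B(L²(Ω, λ)) : L(T) < ∞}`. -/
def EΛ (Ω : Set ℂ) : Subalgebra ℂ (Op Ω) where
  carrier := {T | L T < ∞}
  algebraMap_mem' c := by
    change L (algebraMap ℂ (Op Ω) c) < ∞
    simp [L_algebraMap]
  add_mem' {S T} hS hT := by
    exact (L_add_le S T).trans_lt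
      (ENNReal.mul_lt_top ENNReal.ofNat_lt_top (ENNReal.add_lt_top.2 ⟨hS, hT⟩))
  mul_mem' {S T} hS hT := by
    exact (L_mul_le S T).trans_lt (ENNReal.mul_lt_top ENNReal.ofNat_lt_top (ENNReal.add_lt_top.2
      ⟨ENNReal.mul_lt_top hS enorm_lt_top, ENNReal.mul_lt_top enorm_lt_top hT⟩))

/-! ### The operators `U(w)` and `Z`, and the seminorm `L₁` -/

theorem memLp_e (Ω : Set ℂ) (w : ℂ) :
    MemLp (fun z : ℂ => Complex.exp (Complex.I * ((z * conj w).re : ℂ))) ∞ (leb Ω) := by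
  refine memLp_top_of_bound (Continuous.aestronglyMeasurable (by fun_prop)) 1 (.of_forall ?_)
  intro z
  rw [mul_comm, Complex.norm_exp_ofReal_mul_I]

/-- The function `(e(w))(z) = exp(i Re(z w̄))` on `Ω`. -/
def e (Ω : Set ℂ) (w : ℂ) : LInf Ω := (memLp_e Ω w).toLp _

/-- The operator `U(w)` of multiplication by `e(w)`. -/
def U (Ω : Set ℂ) (w : ℂ) : Op Ω := mulOp (e Ω w)

/-- `L₁(T) = sup {|w|⁻¹ |[T, U(w)]|₂ : w ∈ ℂ, w ≠ 0}`, with values in `[0, ∞]`. -/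
def L₁ {Ω : Set ℂ} (T : Op Ω) : ℝ≥0∞ :=
  ⨆ w : ℂ, ⨆ _ : w ≠ 0, ‖w‖ₑ⁻¹ * hsNorm (T * U Ω w - U Ω w * T)

theorem memLp_id {Ω : Set ℂ} (hΩ : MeasurableSet Ω) (hb : Bornology.IsBounded Ω) :
    MemLp (fun z : ℂ => z) ∞ (leb Ω) := by
  obtain ⟨C, hC⟩ := hb.exists_norm_le
  refine memLp_top_of_bound continuous_id.aestronglyMeasurable C ?_
  filter_upwards [ae_restrict_mem hΩ] with z hz using hC z hz

/-- For bounded `Ω`, the operator `Z` of multiplication by the coordinate function `z`. -/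
def Z {Ω : Set ℂ} (hΩ : MeasurableSet Ω) (hb : Bornology.IsBounded Ω) : Op Ω :=
  mulOp ((memLp_id hΩ hb).toLp _)

/-! ### Norms on `EΛ(Ω)` -/

/-- The norm `|||T||| = ‖T‖ + L(T)` on `EΛ(Ω)`. -/
def triNorm {Ω : Set ℂ} (T : EΛ Ω) : ℝ := ‖(T : Op Ω)‖ + (L (T : Op Ω)).toReal

/-- The norm `|||T|||₁ = ‖T‖ + L₁(T)` on `EΛ(Ω)`. -/
def triNorm₁ {Ω : Set ℂ} (T : EΛ Ω) : ℝ := ‖(T : Op Ω)‖ + (L₁ (T : Op Ω)).toReal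

/-- `p` is a Banach algebra norm on the complex algebra `A`: an algebra norm (a norm of complex
vector spaces with `p (x * y) ≤ p x * p y`) whose metric is complete. -/
def IsBanachAlgebraNorm {A : Type*} [Ring A] [Algebra ℂ A] (p : A → ℝ) : Prop :=
  ∃ N : AlgebraNorm ℂ A, (∀ x, N x = p x) ∧
    @CompleteSpace A N.toRingNorm.toNormedRing.toMetricSpace.toUniformSpace

/-- Equivalence of two norms. -/
def NormEquivalent {A : Type*} (p q : A → ℝ) : Prop :=
  ∃ c C : ℝ, 0 < c ∧ 0 < C ∧ ∀ x, c * p x ≤ q x ∧ q x ≤ C * p x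

end

end ELam

/-!
Everything rests on a comparison of two commutators with the same `T`: if `ψ` is Lipschitz and
injective and `‖f s - f t‖ ≤ C * ‖ψ s - ψ t‖`, then `|[f, T]|₂ ≤ C * |[ψ, T]|₂`, where a function
stands for the multiplication operator. On the level of kernels this is immediate. Multiplication
operators commute, so `[ψ, [f, T]] = [f, [ψ, T]]`, and if both inner commutators are
Hilbert–Schmidt, with kernels `κ` and `k`, then `(ψ s - ψ t) κ(s, t) = (f s - f t) k(s, t)`, whence
`‖κ‖ ≤ C * ‖k‖` almost everywhere.

What has to be proved is therefore that `[f, T]` is Hilbert–Schmidt, and here the dimension of the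
plane enters. Cut a bounded piece of `Ω` into `O(δ⁻²)` cells of diameter `δ` and compress `[f, T]`
to the step functions on them. The compression is of finite rank, and replacing `f` and `ψ` by
their values at the centres of the cells compares it with that of `[ψ, T]`. Each replacement costs
`O(δ)` on each of the `O(δ⁻²)` normalized indicators, hence `O(1)` in the square of the
Hilbert–Schmidt norm, uniformly in `δ`.

For bounded `Ω`, `ψ z = z` gives `L T = |[T, Z]|₂`. In general, `(exp (i t Re z) - 1) / (i t)` and
its analogue for `Im z` converge to `Re z` and `Im z` as `t → 0`, with an error that is small in the
Lipschitz sense on bounded sets; this yields `L ≤ 2 L₁`, the factor being the number of coordinates.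
-/

namespace ELam

noncomputable section

open Filter Topology

section HilbertSchmidt

variable {H : Type*} [NormedAddCommGroup H] [InnerProductSpace ℂ H]

theorem enorm_starProjection_sq {ι : Type*} [Fintype ι] {V : Submodule ℂ H}
    [V.HasOrthogonalProjection] (b : OrthonormalBasis ι ℂ V) (x : H) :
    ‖V.starProjection x‖ₑ ^ 2 = ∑ i, ‖inner ℂ (b i : H) x‖ₑ ^ 2 := by
  have norm_sq : ‖V.starProjection x‖ ^ 2 = ∑ i, ‖inner ℂ (b i : H) x‖ ^ 2 := by
    rw [Submodule.starProjection_apply, ← Submodule.coe_norm, ← b.sum_sq_norm_inner_right]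
    simp only [Submodule.inner_orthogonalProjectionOnto_eq_of_mem_left]
  simp only [← ofReal_norm, ← ENNReal.ofReal_pow (norm_nonneg _), norm_sq]
  exact ENNReal.ofReal_sum_of_nonneg fun _ _ => by positivity

variable [CompleteSpace H]

theorem hsNorm_sq {ι : Type*} (b : HilbertBasis ι ℂ H) (A : H →L[ℂ] H) :
    hsNorm A ^ 2 = ∑' i, ‖A (b i)‖ₑ ^ 2 := by
  rw [hsNorm_eq b, ← ENNReal.rpow_natCast, ← ENNReal.rpow_mul]
  norm_num

theorem hsNorm_neg (A : H →L[ℂ] H) : hsNorm (-A) = hsNorm A := by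
  simp only [hsNorm, neg_apply, enorm_neg]

theorem hsNorm_sub_comm (A B : H →L[ℂ] H) : hsNorm (A - B) = hsNorm (B - A) := by
  rw [← hsNorm_neg, neg_sub]

theorem hsNorm_triangle (A B : H →L[ℂ] H) : hsNorm (A + B) ≤ hsNorm A + hsNorm B := by
  let _ : MeasurableSpace (basisIndex H) := ⊤
  have minkowski := ENNReal.lintegral_Lp_add_le (μ := Measure.count) (p := 2)
    (f := fun i => ‖A (basis H i)‖ₑ) (g := fun i => ‖B (basis H i)‖ₑ)
    measurable_from_top.aemeasurable measurable_from_top.aemeasurable one_le_two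
  simp only [lintegral_count, Pi.add_apply, ENNReal.rpow_two] at minkowski
  refine le_trans ?_ minkowski
  simp only [hsNorm]
  gcongr with i
  exact enorm_add_le _ _

theorem hsNorm_smul (c : ℂ) (A : H →L[ℂ] H) : hsNorm (c • A) = ‖c‖ₑ * hsNorm A := by
  refine (ENNReal.pow_right_strictMono two_ne_zero).injective ?_
  simp only [mul_pow, hsNorm_sq (basis H), ← ENNReal.tsum_mul_left, smul_apply, enorm_smul]

theorem hsNorm_le_of_tendsto {ι : Type*} {l : Filter ι} [l.NeBot] {A : ι → H →L[ℂ] H}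
    {B : H →L[ℂ] H} {C : ℝ≥0∞} (hA : ∀ x, Tendsto (fun n => A n x) l (𝓝 (B x)))
    (hC : ∀ᶠ n in l, hsNorm (A n) ≤ C) : hsNorm B ≤ C := by
  rw [← ENNReal.pow_le_pow_left_iff two_ne_zero, hsNorm_sq (basis H), ENNReal.tsum_eq_iSup_sum]
  refine iSup_le fun s => ?_
  have hsum : Tendsto (fun n => ∑ i ∈ s, ‖A n (basis H i)‖ₑ ^ 2) l
      (𝓝 (∑ i ∈ s, ‖B (basis H i)‖ₑ ^ 2)) :=
    tendsto_finsetSum _ fun i _ => ENNReal.Tendsto.pow (hA _).enorm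
  refine le_of_tendsto hsum ?_
  filter_upwards [hC] with n hn
  calc ∑ i ∈ s, ‖A n (basis H i)‖ₑ ^ 2 ≤ hsNorm (A n) ^ 2 := by
        rw [hsNorm_sq (basis H)]
        exact ENNReal.sum_le_tsum s
    _ ≤ C ^ 2 := by gcongr

theorem tsum_enorm_inner_sq {ι : Type*} (b : HilbertBasis ι ℂ H) (A : H →L[ℂ] H) :
    ∑' p : ι × ι, ‖inner ℂ (b p.1) (A (b p.2))‖ₑ ^ 2 = hsNorm A ^ 2 := by
  rw [hsNorm_sq b, ENNReal.tsum_prod (f := fun i j => ‖inner ℂ (b i) (A (b j))‖ₑ ^ 2),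
    ENNReal.tsum_comm]
  exact tsum_congr fun j => parseval b (A (b j))

open ContinuousLinearMap in
theorem hsNorm_mul_starProjection_sq {ι : Type*} [Fintype ι] {V : Submodule ℂ H}
    [V.HasOrthogonalProjection] (b : OrthonormalBasis ι ℂ V) (A : H →L[ℂ] H) :
    hsNorm (A * V.starProjection) ^ 2 = ∑ i, ‖A (b i)‖ₑ ^ 2 := by
  have adjoint_mul : adjoint (A * V.starProjection) = V.starProjection * adjoint A := by
    rw [← star_eq_adjoint, star_mul, isSelfAdjoint_starProjection, star_eq_adjoint]
  have coefficient (i : ι) (x : H) :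
      ‖inner ℂ (b i : H) (adjoint A x)‖ₑ = ‖inner ℂ x (A (b i))‖ₑ := by
    rw [adjoint_inner_right, ← inner_conj_symm, RCLike.enorm_conj]
  calc hsNorm (A * V.starProjection) ^ 2
      = ∑' j, ∑ i, ‖inner ℂ (b i : H) (adjoint A (basis H j))‖ₑ ^ 2 := by
        rw [← hsNorm_adjoint, adjoint_mul, hsNorm_sq (basis H)]
        exact tsum_congr fun j => enorm_starProjection_sq b _
    _ = ∑ i, ∑' j, ‖inner ℂ (basis H j) (A (b i))‖ₑ ^ 2 := by
        simp only [coefficient]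
        exact Summable.tsum_finsetSum fun _ _ => ENNReal.summable
    _ = ∑ i, ‖A (b i)‖ₑ ^ 2 := by simp only [parseval]

theorem hsNorm_mul_le_of_norm_le_one {A B : H →L[ℂ] H} (hB : ‖B‖ ≤ 1) :
    hsNorm (A * B) ≤ hsNorm A := by
  refine (hsNorm_mul_le' A B).trans (mul_le_of_le_one_right' ?_)
  simpa only [ofReal_norm, ENNReal.ofReal_one] using ENNReal.ofReal_le_ofReal hB

theorem sum_enorm_apply_sq_le_hsNorm_sq {ι : Type*} [Fintype ι] {V : Submodule ℂ H}
    [V.HasOrthogonalProjection] (b : OrthonormalBasis ι ℂ V) (A : H →L[ℂ] H) :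
    ∑ i, ‖A (b i)‖ₑ ^ 2 ≤ hsNorm A ^ 2 := by
  rw [← hsNorm_mul_starProjection_sq b]
  gcongr
  exact hsNorm_mul_le_of_norm_le_one V.starProjection_norm_le

end HilbertSchmidt

section Multiplication

variable {α β : Type*} [MeasurableSpace α] [MeasurableSpace β] {μ : Measure α} {ν : Measure β}

variable (μ) in
/-- The representation of `L^∞(μ)` on `L²(μ)` by multiplication, for an arbitrary measure `μ`. For
`μ = leb Ω` it is `mulOp`, definitionally. -/
def mulL : Lp ℂ ∞ μ →L[ℂ] Lp ℂ 2 μ →L[ℂ] Lp ℂ 2 μ :=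
  (ContinuousLinearMap.mul ℂ ℂ).holderL μ ∞ 2 2

theorem mulL_coeFn (φ : Lp ℂ ∞ μ) (x : Lp ℂ 2 μ) : mulL μ φ x =ᵐ[μ] fun a => φ a * x a :=
  ContinuousLinearMap.coeFn_holder _ _ _

theorem mulL_commute (φ ψ : Lp ℂ ∞ μ) : Commute (mulL μ φ) (mulL μ ψ) := by
  refine ContinuousLinearMap.ext fun x => Lp.ext ?_
  change mulL μ φ (mulL μ ψ x) =ᵐ[μ] mulL μ ψ (mulL μ φ x)
  filter_upwards [mulL_coeFn φ (mulL μ ψ x), mulL_coeFn ψ (mulL μ φ x), mulL_coeFn φ x,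
    mulL_coeFn ψ x] with a h₁ h₂ h₃ h₄
  rw [h₁, h₂, h₃, h₄, mul_left_comm]

theorem mulL_apply_eq {φ : Lp ℂ ∞ μ} {x y : Lp ℂ 2 μ} (h : ∀ᵐ a ∂μ, φ a * x a = y a) :
    mulL μ φ x = y :=
  Lp.ext ((mulL_coeFn φ x).trans h)

theorem norm_mulL_apply_le {S : Set α} {φ ψ : Lp ℂ ∞ μ} {x : Lp ℂ 2 μ} {C : ℝ}
    (hx : ∀ᵐ a ∂μ, a ∉ S → x a = 0) (h : ∀ᵐ a ∂μ, a ∈ S → ‖φ a‖ ≤ C * ‖ψ a‖) :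
    ‖mulL μ φ x‖ ≤ C * ‖mulL μ ψ x‖ := by
  refine Lp.norm_le_mul_norm_of_ae_le_mul ?_
  filter_upwards [h, hx, mulL_coeFn φ x, mulL_coeFn ψ x] with a ha hxa h₁ h₂
  rw [h₁, h₂, norm_mul, norm_mul, ← mul_assoc]
  by_cases haS : a ∈ S
  · exact mul_le_mul_of_nonneg_right (ha haS) (norm_nonneg _)
  · simp only [hxa haS, norm_zero, mul_zero, le_refl]

theorem norm_mulL_apply_le_mul_norm {S : Set α} {φ : Lp ℂ ∞ μ} {x : Lp ℂ 2 μ} {C : ℝ}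
    (hx : ∀ᵐ a ∂μ, a ∉ S → x a = 0) (h : ∀ᵐ a ∂μ, a ∈ S → ‖φ a‖ ≤ C) :
    ‖mulL μ φ x‖ ≤ C * ‖x‖ := by
  refine Lp.norm_le_mul_norm_of_ae_le_mul ?_
  filter_upwards [h, hx, mulL_coeFn φ x] with a ha hxa h₁
  rw [h₁, norm_mul]
  by_cases haS : a ∈ S
  · exact mul_le_mul_of_nonneg_right (ha haS) (norm_nonneg _)
  · simp only [hxa haS, norm_zero, mul_zero, le_refl]

theorem inner_mulL_star_left (φ : Lp ℂ ∞ μ) (x y : Lp ℂ 2 μ) :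
    inner ℂ (mulL μ (star φ) x) y = inner ℂ x (mulL μ φ y) := by
  rw [L2.inner_def, L2.inner_def]
  refine integral_congr_ae ?_
  filter_upwards [mulL_coeFn (star φ) x, mulL_coeFn φ y, Lp.coeFn_star φ] with a h₁ h₂ h₃
  simp only [h₁, h₂, h₃, Pi.star_apply, RCLike.inner_apply, map_mul, RCLike.star_def,
    RCLike.conj_conj]
  ring

theorem memLp_top_comp (φ : Lp ℂ ∞ ν) {q : α → β} (hq : Measure.QuasiMeasurePreserving q μ ν) :
    MemLp (φ ∘ q) ∞ μ :=
  memLp_top_of_bound ((Lp.aestronglyMeasurable φ).comp_quasiMeasurePreserving hq)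
    (lpNorm φ ∞ ν) (hq.ae (ae_le_lpNorm_exponent_top (Lp.memLp φ)))

/-- The pullback `φ ∘ q` of a bounded function along a map `q` that reflects null sets, as an
element of `L^∞`. -/
def pullback {q : α → β} (hq : Measure.QuasiMeasurePreserving q μ ν) (φ : Lp ℂ ∞ ν) : Lp ℂ ∞ μ :=
  (memLp_top_comp φ hq).toLp _

theorem pullback_coeFn {q : α → β} (hq : Measure.QuasiMeasurePreserving q μ ν) (φ : Lp ℂ ∞ ν) :
    pullback hq φ =ᵐ[μ] φ ∘ q :=
  (memLp_top_comp φ hq).coeFn_toLp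

end Multiplication

section Kernel

variable {α : Type*} [MeasurableSpace α] {μ : Measure α}

theorem memLp_tensor (g h : Lp ℂ 2 μ) :
    MemLp (fun p : α × α => g p.1 * conj (h p.2)) 2 (μ.prod μ) := by
  have hg := Lp.memLp g
  have hh := Lp.memLp h
  have aestronglyMeasurable :
      AEStronglyMeasurable (fun p : α × α => g p.1 * conj (h p.2)) (μ.prod μ) :=
    hg.1.comp_fst.mul (Complex.continuous_conj.comp_aestronglyMeasurable hh.1.comp_snd)
  rw [memLp_two_iff_integrable_sq_norm aestronglyMeasurable]
  simp only [norm_mul, RCLike.norm_conj, mul_pow]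
  exact ((memLp_two_iff_integrable_sq_norm hg.1).1 hg).mul_prod
    ((memLp_two_iff_integrable_sq_norm hh.1).1 hh)

/-- The kernel `(s, t) ↦ g(s) conj(h(t))` of the rank one operator `x ↦ ⟪h, x⟫ g`. -/
def tensor (g h : Lp ℂ 2 μ) : Lp ℂ 2 (μ.prod μ) := (memLp_tensor g h).toLp _

theorem tensor_coeFn (g h : Lp ℂ 2 μ) :
    tensor g h =ᵐ[μ.prod μ] fun p => g p.1 * conj (h p.2) := (memLp_tensor g h).coeFn_toLp

theorem tensor_add_left (g g' h : Lp ℂ 2 μ) : tensor (g + g') h = tensor g h + tensor g' h := by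
  refine Lp.ext ?_
  filter_upwards [tensor_coeFn (g + g') h, tensor_coeFn g h, tensor_coeFn g' h,
    Lp.coeFn_add (tensor g h) (tensor g' h),
    Measure.quasiMeasurePreserving_fst.ae (Lp.coeFn_add g g')] with p h₁ h₂ h₃ h₄ h₅
  rw [h₁, h₄, Pi.add_apply, h₂, h₃, h₅, Pi.add_apply, add_mul]

theorem tensor_add_right (g h h' : Lp ℂ 2 μ) : tensor g (h + h') = tensor g h + tensor g h' := by
  refine Lp.ext ?_
  filter_upwards [tensor_coeFn g (h + h'), tensor_coeFn g h, tensor_coeFn g h',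
    Lp.coeFn_add (tensor g h) (tensor g h'),
    Measure.quasiMeasurePreserving_snd.ae (Lp.coeFn_add h h')] with p h₁ h₂ h₃ h₄ h₅
  rw [h₁, h₄, Pi.add_apply, h₂, h₃, h₅, Pi.add_apply, map_add, mul_add]

theorem tensor_smul_left (c : ℂ) (g h : Lp ℂ 2 μ) : tensor (c • g) h = c • tensor g h := by
  refine Lp.ext ?_
  filter_upwards [tensor_coeFn (c • g) h, tensor_coeFn g h, Lp.coeFn_smul c (tensor g h),
    Measure.quasiMeasurePreserving_fst.ae (Lp.coeFn_smul c g)] with p h₁ h₂ h₃ h₄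
  rw [h₁, h₃, Pi.smul_apply, h₂, h₄, Pi.smul_apply, smul_eq_mul, smul_eq_mul, mul_assoc]

theorem tensor_smul_right (c : ℂ) (g h : Lp ℂ 2 μ) : tensor g (c • h) = conj c • tensor g h := by
  refine Lp.ext ?_
  filter_upwards [tensor_coeFn g (c • h), tensor_coeFn g h, Lp.coeFn_smul (conj c) (tensor g h),
    Measure.quasiMeasurePreserving_snd.ae (Lp.coeFn_smul c h)] with p h₁ h₂ h₃ h₄
  rw [h₁, h₃, Pi.smul_apply, h₂, h₄, Pi.smul_apply, smul_eq_mul, smul_eq_mul, map_mul,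
    mul_left_comm]

theorem tensor_mulL_left (φ : Lp ℂ ∞ μ) (g h : Lp ℂ 2 μ) :
    tensor (mulL μ (star φ) g) h
      = mulL (μ.prod μ) (star (pullback Measure.quasiMeasurePreserving_fst φ)) (tensor g h) := by
  refine (mulL_apply_eq ?_).symm
  filter_upwards [tensor_coeFn (mulL μ (star φ) g) h, tensor_coeFn g h,
    pullback_coeFn (μ := μ.prod μ) Measure.quasiMeasurePreserving_fst φ,
    Lp.coeFn_star (pullback (μ := μ.prod μ) Measure.quasiMeasurePreserving_fst φ),
    Measure.quasiMeasurePreserving_fst.ae (mulL_coeFn (star φ) g),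
    Measure.quasiMeasurePreserving_fst.ae (Lp.coeFn_star φ)] with p h₁ h₂ h₃ h₄ h₅ h₆
  rw [h₁, h₂, h₄, h₅, h₆, Pi.star_apply, Pi.star_apply, h₃, Function.comp_apply, mul_assoc]

theorem tensor_mulL_right (φ : Lp ℂ ∞ μ) (g h : Lp ℂ 2 μ) :
    tensor g (mulL μ φ h)
      = mulL (μ.prod μ) (star (pullback Measure.quasiMeasurePreserving_snd φ)) (tensor g h) := by
  refine (mulL_apply_eq ?_).symm
  filter_upwards [tensor_coeFn g (mulL μ φ h), tensor_coeFn g h,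
    pullback_coeFn (μ := μ.prod μ) Measure.quasiMeasurePreserving_snd φ,
    Lp.coeFn_star (pullback (μ := μ.prod μ) Measure.quasiMeasurePreserving_snd φ),
    Measure.quasiMeasurePreserving_snd.ae (mulL_coeFn φ h)] with p h₁ h₂ h₃ h₄ h₅
  rw [h₁, h₂, h₄, h₅, Pi.star_apply, h₃, Function.comp_apply, map_mul, RCLike.star_def,
    mul_left_comm]

theorem ae_eq_zero_of_forall_setIntegral_prod_eq_zero {β : Type*} [MeasurableSpace β]
    {ρ : Measure (α × β)} {F : α × β → ℂ} (hF : Integrable F ρ)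
    (h : ∀ s t, MeasurableSet s → MeasurableSet t → ∫ p in s ×ˢ t, F p ∂ρ = 0) : F =ᵐ[ρ] 0 := by
  suffices ∀ A, MeasurableSet A → ∫ p in A, F p ∂ρ = 0 from
    hF.ae_eq_zero_of_forall_setIntegral_eq_zero fun A hA _ => this A hA
  intro A hA
  induction A, hA using
    MeasurableSpace.induction_on_inter generateFrom_prod.symm isPiSystem_prod with
  | empty => rw [setIntegral_empty]
  | basic A hA =>
    obtain ⟨s, hs, t, ht, rfl⟩ := hA
    exact h s t hs ht
  | compl A hA ih =>
    have total := h Set.univ Set.univ .univ .univ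
    rw [Set.univ_prod_univ, setIntegral_univ] at total
    rw [setIntegral_compl hA hF, ih, total, sub_zero]
  | iUnion A hd hA ih =>
    rw [integral_iUnion hA hd hF.integrableOn]
    simp only [ih, tsum_zero]

variable [SigmaFinite μ]

theorem inner_tensor_indicatorConstLp {s t : Set α} (hs : MeasurableSet s) (hμs : μ s ≠ ∞)
    (ht : MeasurableSet t) (hμt : μ t ≠ ∞) (K : Lp ℂ 2 (μ.prod μ)) :
    inner ℂ (tensor (indicatorConstLp 2 hs hμs 1) (indicatorConstLp 2 ht hμt 1)) K
      = ∫ p in s ×ˢ t, K p ∂μ.prod μ := by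
  have hμst : μ.prod μ (s ×ˢ t) ≠ ∞ := by
    rw [Measure.prod_prod]
    exact ENNReal.mul_ne_top hμs hμt
  rw [← L2.inner_indicatorConstLp_one (hs.prod ht) hμst]
  congr 1
  refine Lp.ext ?_
  filter_upwards [tensor_coeFn (indicatorConstLp 2 hs hμs (1 : ℂ)) (indicatorConstLp 2 ht hμt 1),
    indicatorConstLp_coeFn (hs := hs.prod ht) (hμs := hμst) (p := 2) (c := (1 : ℂ)),
    Measure.quasiMeasurePreserving_fst.ae
      (indicatorConstLp_coeFn (hs := hs) (hμs := hμs) (p := 2) (c := (1 : ℂ))),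
    Measure.quasiMeasurePreserving_snd.ae
      (indicatorConstLp_coeFn (hs := ht) (hμs := hμt) (p := 2) (c := (1 : ℂ)))] with p h₁ h₂ h₃ h₄
  rw [h₁, h₂, h₃, h₄]
  by_cases h₅ : p.1 ∈ s <;> by_cases h₆ : p.2 ∈ t <;> simp [h₅, h₆]

theorem eq_zero_of_forall_inner_tensor_eq_zero {K : Lp ℂ 2 (μ.prod μ)}
    (h : ∀ g g' : Lp ℂ 2 μ, inner ℂ (tensor g g') K = 0) : K = 0 := by
  let S := spanningSets μ
  have ae_zero_on_square (n : ℕ) : K =ᵐ[(μ.prod μ).restrict (S n ×ˢ S n)] 0 := by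
    have hSn : MeasurableSet (S n) := measurableSet_spanningSets μ n
    have hμSn : μ (S n) < ∞ := measure_spanningSets_lt_top μ n
    have : IsFiniteMeasure ((μ.prod μ).restrict (S n ×ˢ S n)) := by
      rw [← Measure.prod_restrict]
      have : Fact (μ (S n) < ∞) := ⟨hμSn⟩
      infer_instance
    refine ae_eq_zero_of_forall_setIntegral_prod_eq_zero
      (((Lp.memLp K).restrict _).integrable one_le_two) fun s t hs ht => ?_
    have inter_ne_top (s : Set α) : μ (s ∩ S n) ≠ ∞ :=
      (measure_inter_lt_top_of_right_ne_top hμSn.ne).ne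
    rw [Measure.restrict_restrict (hs.prod ht), Set.prod_inter_prod,
      ← inner_tensor_indicatorConstLp (hs.inter hSn) (inter_ne_top s) (ht.inter hSn)
        (inter_ne_top t), h]
  have squares_cover : ⋃ n, S n ×ˢ S n = Set.univ := by
    rw [Set.iUnion_prod_of_monotone (monotone_spanningSets μ) (monotone_spanningSets μ),
      iUnion_spanningSets, Set.univ_prod_univ]
  have ae_zero := (ae_restrict_iUnion_iff (fun n => S n ×ˢ S n) (fun p => K p = 0)).2
    ae_zero_on_square
  rw [squares_cover, Measure.restrict_univ] at ae_zero
  exact (Lp.eq_zero_iff_ae_eq_zero).2 ae_zero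

theorem inner_tensor_tensor (g h g' h' : Lp ℂ 2 μ) :
    inner ℂ (tensor g h) (tensor g' h') = inner ℂ g g' * inner ℂ h' h := by
  rw [L2.inner_def, L2.inner_def, L2.inner_def, ← integral_prod_mul]
  refine integral_congr_ae ?_
  filter_upwards [tensor_coeFn g h, tensor_coeFn g' h'] with p h₁ h₂
  simp only [h₁, h₂, RCLike.inner_apply, map_mul, RCLike.conj_conj]
  ring

theorem norm_tensor (g h : Lp ℂ 2 μ) : ‖tensor g h‖ = ‖g‖ * ‖h‖ := by
  have norm_sq := inner_tensor_tensor g h g h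
  simp only [inner_self_eq_norm_sq_to_K] at norm_sq
  rw [← sq_eq_sq₀ (norm_nonneg _) (by positivity), mul_pow]
  exact_mod_cast norm_sq

theorem orthonormal_tensor {ι : Type*} {v : ι → Lp ℂ 2 μ} (hv : Orthonormal ℂ v) :
    Orthonormal ℂ fun p : ι × ι => tensor (v p.1) (v p.2) := by
  classical
  rw [orthonormal_iff_ite] at hv ⊢
  rintro ⟨i, j⟩ ⟨i', j'⟩
  simp only [inner_tensor_tensor, hv, Prod.mk.injEq, eq_comm (a := j'), ite_and, mul_ite, mul_one,
    mul_zero]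
  split_ifs <;> rfl

/-- The sesquilinear form `(g, h) ↦ ⟪tensor g h, K⟫ = ∫ conj(g(s)) K(s, t) h(t)` of the kernel
`K`. -/
def kernelForm (K : Lp ℂ 2 (μ.prod μ)) : Lp ℂ 2 μ →L⋆[ℂ] Lp ℂ 2 μ →L[ℂ] ℂ :=
  LinearMap.mkContinuous₂
    (LinearMap.mk₂'ₛₗ _ _ (fun g h => inner ℂ (tensor g h) K)
      (fun g g' h => by rw [tensor_add_left, inner_add_left])
      (fun c g h => by rw [tensor_smul_left, inner_smul_left, smul_eq_mul])
      (fun g h h' => by rw [tensor_add_right, inner_add_left])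
      (fun c g h => by
        rw [tensor_smul_right, inner_smul_left, RCLike.conj_conj, RingHom.id_apply, smul_eq_mul]))
    ‖K‖ fun g h => by
      refine (norm_inner_le_norm (𝕜 := ℂ) (tensor g h) K).trans_eq ?_
      rw [norm_tensor, mul_comm, mul_assoc]

theorem kernelForm_apply (K : Lp ℂ 2 (μ.prod μ)) (g h : Lp ℂ 2 μ) :
    kernelForm K g h = inner ℂ (tensor g h) K := rfl

theorem span_range_tensor_orthogonal_eq_bot {ι : Type*} (b : HilbertBasis ι ℂ (Lp ℂ 2 μ)) :
    (Submodule.span ℂ (Set.range fun p : ι × ι => tensor (b p.1) (b p.2)))ᗮ = ⊥ := by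
  refine (Submodule.eq_bot_iff _).2 fun K hK => ?_
  have dense := Submodule.dense_iff_topologicalClosure_eq_top.2 b.dense_span
  have form_eq_zero : kernelForm K = 0 := by
    refine ContinuousLinearMap.ext_on dense ?_
    rintro _ ⟨i, rfl⟩
    refine ContinuousLinearMap.ext_on dense ?_
    rintro _ ⟨j, rfl⟩
    exact hK _ (Submodule.subset_span ⟨(i, j), rfl⟩)
  refine eq_zero_of_forall_inner_tensor_eq_zero fun g h => ?_
  rw [← kernelForm_apply, form_eq_zero, zero_apply, zero_apply]

/-- The tensors of the vectors of an orthonormal basis of `L²(μ)`, as an orthonormal basis of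
`L²(μ ⊗ μ)`. -/
def tensorBasis {ι : Type*} (b : HilbertBasis ι ℂ (Lp ℂ 2 μ)) :
    HilbertBasis (ι × ι) ℂ (Lp ℂ 2 (μ.prod μ)) :=
  HilbertBasis.mkOfOrthogonalEqBot (orthonormal_tensor b.orthonormal)
    (span_range_tensor_orthogonal_eq_bot b)

theorem tensorBasis_apply {ι : Type*} (b : HilbertBasis ι ℂ (Lp ℂ 2 μ)) (p : ι × ι) :
    tensorBasis b p = tensor (b p.1) (b p.2) := by
  rw [tensorBasis, HilbertBasis.coe_mkOfOrthogonalEqBot]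

/-- The integral operator on `L²(μ)` with square integrable kernel `K`. -/
def kernelOp (K : Lp ℂ 2 (μ.prod μ)) : Lp ℂ 2 μ →L[ℂ] Lp ℂ 2 μ :=
  ContinuousLinearMap.adjoint (InnerProductSpace.continuousLinearMapOfBilin (kernelForm K))

theorem inner_kernelOp (K : Lp ℂ 2 (μ.prod μ)) (g h : Lp ℂ 2 μ) :
    inner ℂ g (kernelOp K h) = inner ℂ (tensor g h) K := by
  rw [kernelOp, ContinuousLinearMap.adjoint_inner_right,
    InnerProductSpace.continuousLinearMapOfBilin_apply, kernelForm_apply]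

theorem kernelOp_injective :
    Function.Injective (kernelOp : Lp ℂ 2 (μ.prod μ) → Lp ℂ 2 μ →L[ℂ] Lp ℂ 2 μ) := by
  intro K K' h
  refine sub_eq_zero.1 (eq_zero_of_forall_inner_tensor_eq_zero fun g g' => ?_)
  rw [inner_sub_right, ← inner_kernelOp, ← inner_kernelOp, h, sub_self]

theorem kernelOp_sub (K K' : Lp ℂ 2 (μ.prod μ)) :
    kernelOp (K - K') = kernelOp K - kernelOp K' := by
  refine ContinuousLinearMap.ext fun h => ext_inner_left ℂ fun g => ?_
  simp only [sub_apply, inner_sub_right, inner_kernelOp]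

theorem mulL_mul_kernelOp (φ : Lp ℂ ∞ μ) (K : Lp ℂ 2 (μ.prod μ)) :
    mulL μ φ * kernelOp K
      = kernelOp (mulL (μ.prod μ) (pullback Measure.quasiMeasurePreserving_fst φ) K) := by
  refine ContinuousLinearMap.ext fun h => ext_inner_left ℂ fun g => ?_
  rw [mul_apply_eq_comp, ← inner_mulL_star_left, inner_kernelOp, inner_kernelOp, tensor_mulL_left,
    inner_mulL_star_left]

theorem kernelOp_mul_mulL (φ : Lp ℂ ∞ μ) (K : Lp ℂ 2 (μ.prod μ)) :
    kernelOp K * mulL μ φ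
      = kernelOp (mulL (μ.prod μ) (pullback Measure.quasiMeasurePreserving_snd φ) K) := by
  refine ContinuousLinearMap.ext fun h => ext_inner_left ℂ fun g => ?_
  rw [mul_apply_eq_comp, inner_kernelOp, inner_kernelOp, tensor_mulL_right, inner_mulL_star_left]

theorem hsNorm_kernelOp (K : Lp ℂ 2 (μ.prod μ)) : hsNorm (kernelOp K) = ‖K‖ₑ := by
  refine (ENNReal.pow_right_strictMono two_ne_zero).injective ?_
  simp only [← tsum_enorm_inner_sq (basis (Lp ℂ 2 μ)), inner_kernelOp,
    ← parseval (tensorBasis (basis (Lp ℂ 2 μ))), tensorBasis_apply]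

theorem exists_kernelOp_eq {X : Lp ℂ 2 μ →L[ℂ] Lp ℂ 2 μ} (hX : hsNorm X ≠ ∞) :
    ∃ K, kernelOp K = X := by
  let b := basis (Lp ℂ 2 μ)
  let c : basisIndex (Lp ℂ 2 μ) × basisIndex (Lp ℂ 2 μ) → ℂ := fun p => inner ℂ (b p.1) (X (b p.2))
  have c_sq_summable : ∑' p, ‖c p‖ₑ ^ 2 ≠ ∞ := by
    rw [tsum_enorm_inner_sq b]
    exact ENNReal.pow_ne_top hX
  have memℓp_c : Memℓp c 2 := by
    rw [memℓp_gen_iff (by norm_num)]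
    simpa using ENNReal.summable_toReal c_sq_summable
  refine ⟨(tensorBasis b).repr.symm ⟨c, memℓp_c⟩, ?_⟩
  refine ContinuousLinearMap.ext_on
    (Submodule.dense_iff_topologicalClosure_eq_top.2 b.dense_span) ?_
  rintro _ ⟨j, rfl⟩
  refine b.repr.injective (lp.ext (funext fun i => ?_))
  rw [b.repr_apply_apply, b.repr_apply_apply, inner_kernelOp, ← tensorBasis_apply b (i, j),
    ← HilbertBasis.repr_apply_apply, LinearIsometryEquiv.apply_symm_apply]

end Kernel

section Cutoff

variable {α : Type*} [MeasurableSpace α] {μ : Measure α} {B : Set α}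

variable (μ) in
/-- The orthogonal projection of `L²(μ)` onto the functions vanishing outside `B`: multiplication
by the indicator of `B`. -/
def cutoff (hB : MeasurableSet B) : Lp ℂ 2 μ →L[ℂ] Lp ℂ 2 μ :=
  mulL μ (((memLp_top_const (1 : ℂ)).indicator hB).toLp _)

theorem cutoff_coeFn (hB : MeasurableSet B) (x : Lp ℂ 2 μ) :
    cutoff μ hB x =ᵐ[μ] B.indicator x := by
  filter_upwards [mulL_coeFn _ x, ((memLp_top_const (1 : ℂ)).indicator hB).coeFn_toLp (μ := μ)]
    with a h₁ h₂
  rw [cutoff, h₁, h₂]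
  by_cases ha : a ∈ B <;> simp [ha]

theorem mulL_commute_cutoff (φ : Lp ℂ ∞ μ) (hB : MeasurableSet B) :
    Commute (mulL μ φ) (cutoff μ hB) :=
  mulL_commute _ _

theorem cutoff_apply_eq_self (hB : MeasurableSet B) {x : Lp ℂ 2 μ}
    (hx : ∀ᵐ a ∂μ, a ∉ B → x a = 0) : cutoff μ hB x = x := by
  refine Lp.ext ?_
  filter_upwards [cutoff_coeFn hB x, hx] with a h₁ h₂
  rw [h₁, Set.indicator_apply_eq_self]
  exact h₂

theorem cutoff_apply_ae_eq_zero (hB : MeasurableSet B) (x : Lp ℂ 2 μ) :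
    ∀ᵐ a ∂μ, a ∉ B → cutoff μ hB x a = 0 := by
  filter_upwards [cutoff_coeFn hB x] with a ha haB
  exact ha.trans (Set.indicator_of_notMem haB _)

theorem cutoff_mul_self (hB : MeasurableSet B) : cutoff μ hB * cutoff μ hB = cutoff μ hB :=
  ContinuousLinearMap.ext fun x => cutoff_apply_eq_self hB (cutoff_apply_ae_eq_zero hB x)

theorem cutoff_eq_one (hB : MeasurableSet B) (h : ∀ᵐ a ∂μ, a ∈ B) : cutoff μ hB = 1 :=
  ContinuousLinearMap.ext fun _ => cutoff_apply_eq_self hB (h.mono fun _ ha ha' => absurd ha ha')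

theorem norm_cutoff_le_one (hB : MeasurableSet B) : ‖cutoff μ hB‖ ≤ 1 := by
  refine ContinuousLinearMap.opNorm_le_bound _ zero_le_one fun x =>
    Lp.norm_le_mul_norm_of_ae_le_mul ?_
  filter_upwards [cutoff_coeFn hB x] with a ha
  rw [ha, one_mul]
  exact norm_indicator_le_norm_self _ _

/-- The compression of the commutator `[M_φ, T]` to the functions vanishing outside `B`. -/
def cutCommutator (hB : MeasurableSet B) (φ : Lp ℂ ∞ μ) (T : Lp ℂ 2 μ →L[ℂ] Lp ℂ 2 μ) :
    Lp ℂ 2 μ →L[ℂ] Lp ℂ 2 μ :=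
  cutoff μ hB * (mulL μ φ * T - T * mulL μ φ) * cutoff μ hB

theorem cutoff_mul_cutCommutator_mul_cutoff (hB : MeasurableSet B) (φ : Lp ℂ ∞ μ)
    (T : Lp ℂ 2 μ →L[ℂ] Lp ℂ 2 μ) :
    cutoff μ hB * cutCommutator hB φ T * cutoff μ hB = cutCommutator hB φ T := by
  simp only [cutCommutator, mul_assoc, cutoff_mul_self]
  simp only [← mul_assoc, cutoff_mul_self]

theorem commutator_compression {R : Type*} [Ring R] {p f : R} (h : Commute f p) (t : R) :
    f * (p * t * p) - p * t * p * f = p * (f * t - t * f) * p := by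
  simp only [mul_sub, sub_mul, mul_assoc, h.left_comm, ← h.eq]

theorem commutator_commutator_comm {R : Type*} [Ring R] {f g : R} (h : Commute f g) (t : R) :
    g * (f * t - t * f) - (f * t - t * f) * g = f * (g * t - t * g) - (g * t - t * g) * f := by
  simp only [mul_sub, sub_mul, mul_assoc, h.left_comm, h.eq]
  abel

theorem mulL_commutator_cutCommutator_comm (hB : MeasurableSet B) (φ ψ : Lp ℂ ∞ μ)
    (T : Lp ℂ 2 μ →L[ℂ] Lp ℂ 2 μ) :
    mulL μ ψ * cutCommutator hB φ T - cutCommutator hB φ T * mulL μ ψ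
      = mulL μ φ * cutCommutator hB ψ T - cutCommutator hB ψ T * mulL μ φ := by
  rw [cutCommutator, cutCommutator, commutator_compression (mulL_commute_cutoff ψ hB),
    commutator_compression (mulL_commute_cutoff φ hB),
    commutator_commutator_comm (mulL_commute φ ψ)]

section Kernel

variable [SigmaFinite μ]

theorem ae_eq_of_kernelOp_commutator_eq {φ ψ : Lp ℂ ∞ μ} {K K' : Lp ℂ 2 (μ.prod μ)}
    (h : mulL μ φ * kernelOp K - kernelOp K * mulL μ φ
      = mulL μ ψ * kernelOp K' - kernelOp K' * mulL μ ψ) :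
    ∀ᵐ p ∂μ.prod μ, (φ p.1 - φ p.2) * K p = (ψ p.1 - ψ p.2) * K' p := by
  simp only [mulL_mul_kernelOp, kernelOp_mul_mulL, ← kernelOp_sub] at h
  have commutator_kernel (φ : Lp ℂ ∞ μ) (K : Lp ℂ 2 (μ.prod μ)) :
      (mulL (μ.prod μ) (pullback Measure.quasiMeasurePreserving_fst φ) K
        - mulL (μ.prod μ) (pullback Measure.quasiMeasurePreserving_snd φ) K : Lp ℂ 2 (μ.prod μ))
        =ᵐ[μ.prod μ] fun p => (φ p.1 - φ p.2) * K p := by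
    refine (Lp.coeFn_sub _ _).trans ?_
    filter_upwards [mulL_coeFn (pullback Measure.quasiMeasurePreserving_fst φ) K,
      mulL_coeFn (pullback Measure.quasiMeasurePreserving_snd φ) K,
      pullback_coeFn (μ := μ.prod μ) Measure.quasiMeasurePreserving_fst φ,
      pullback_coeFn (μ := μ.prod μ) Measure.quasiMeasurePreserving_snd φ] with p h₁ h₂ h₃ h₄
    rw [Pi.sub_apply, h₁, h₂, h₃, h₄, Function.comp_apply, Function.comp_apply, sub_mul]
  have commutator_kernel_eq := commutator_kernel ψ K'
  rw [← kernelOp_injective h] at commutator_kernel_eq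
  exact (commutator_kernel φ K).symm.trans commutator_kernel_eq

theorem ae_eq_zero_of_cutoff_mul_kernelOp_mul_cutoff_eq (hB : MeasurableSet B)
    {K : Lp ℂ 2 (μ.prod μ)} (h : cutoff μ hB * kernelOp K * cutoff μ hB = kernelOp K) :
    ∀ᵐ p ∂μ.prod μ, ¬ (p.1 ∈ B ∧ p.2 ∈ B) → K p = 0 := by
  let χ : Lp ℂ ∞ μ := ((memLp_top_const (1 : ℂ)).indicator hB).toLp _
  have χ_coeFn : χ =ᵐ[μ] B.indicator fun _ => 1 := MemLp.coeFn_toLp _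
  rw [cutoff, mulL_mul_kernelOp, kernelOp_mul_mulL] at h
  have kernel_eq := kernelOp_injective h
  let χ₁ := pullback (μ := μ.prod μ) Measure.quasiMeasurePreserving_fst χ
  let χ₂ := pullback (μ := μ.prod μ) Measure.quasiMeasurePreserving_snd χ
  filter_upwards [mulL_coeFn χ₂ (mulL _ χ₁ K), mulL_coeFn χ₁ K,
    pullback_coeFn (μ := μ.prod μ) Measure.quasiMeasurePreserving_fst χ,
    pullback_coeFn (μ := μ.prod μ) Measure.quasiMeasurePreserving_snd χ,
    Measure.quasiMeasurePreserving_fst.ae χ_coeFn, Measure.quasiMeasurePreserving_snd.ae χ_coeFn]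
    with p h₁ h₂ h₃ h₄ h₅ h₆ hp
  rw [kernel_eq, h₂, h₃, h₄, Function.comp_apply, Function.comp_apply, h₅, h₆] at h₁
  rw [h₁]
  by_cases hp₁ : p.1 ∈ B
  · rw [Set.indicator_of_notMem (fun hp₂ => hp ⟨hp₁, hp₂⟩) _, zero_mul]
  · rw [Set.indicator_of_notMem hp₁, zero_mul, mul_zero]

theorem hsNorm_cutCommutator_le_of_ne_top (hB : MeasurableSet B) {φ ψ : Lp ℂ ∞ μ}
    {T : Lp ℂ 2 μ →L[ℂ] Lp ℂ 2 μ} {C : ℝ} (hC : 0 ≤ C)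
    (hφ : hsNorm (cutCommutator hB φ T) ≠ ∞) (hψ : hsNorm (cutCommutator hB ψ T) ≠ ∞)
    (hle : ∀ᵐ p ∂μ.prod μ, p.1 ∈ B → p.2 ∈ B → ‖φ p.1 - φ p.2‖ ≤ C * ‖ψ p.1 - ψ p.2‖)
    (hne : ∀ᵐ p ∂μ.prod μ, p.1 ∈ B → p.2 ∈ B → ψ p.1 ≠ ψ p.2) :
    hsNorm (cutCommutator hB φ T) ≤ ENNReal.ofReal C * hsNorm (cutCommutator hB ψ T) := by
  obtain ⟨K, hK⟩ := exists_kernelOp_eq hφ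
  obtain ⟨K', hK'⟩ := exists_kernelOp_eq hψ
  have kernel_eq : ∀ᵐ p ∂μ.prod μ, (ψ p.1 - ψ p.2) * K p = (φ p.1 - φ p.2) * K' p := by
    refine ae_eq_of_kernelOp_commutator_eq ?_
    rw [hK, hK', mulL_commutator_cutCommutator_comm]
  have kernel_support : ∀ᵐ p ∂μ.prod μ, ¬ (p.1 ∈ B ∧ p.2 ∈ B) → K p = 0 := by
    refine ae_eq_zero_of_cutoff_mul_kernelOp_mul_cutoff_eq hB ?_
    rw [hK, cutoff_mul_cutCommutator_mul_cutoff]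
  have kernel_le : ∀ᵐ p ∂μ.prod μ, ‖K p‖ ≤ C * ‖K' p‖ := by
    filter_upwards [kernel_eq, kernel_support, hle, hne] with p heq hsupp hle hne
    by_cases hp : p.1 ∈ B ∧ p.2 ∈ B
    · have hpos : 0 < ‖ψ p.1 - ψ p.2‖ := norm_pos_iff.2 (sub_ne_zero.2 (hne hp.1 hp.2))
      refine le_of_mul_le_mul_left ?_ hpos
      calc ‖ψ p.1 - ψ p.2‖ * ‖K p‖ = ‖φ p.1 - φ p.2‖ * ‖K' p‖ := by
            rw [← norm_mul, heq, norm_mul]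
        _ ≤ C * ‖ψ p.1 - ψ p.2‖ * ‖K' p‖ := by
            gcongr
            exact hle hp.1 hp.2
        _ = ‖ψ p.1 - ψ p.2‖ * (C * ‖K' p‖) := by ring
    · rw [hsupp hp, norm_zero]
      positivity
  rw [← hK, ← hK', hsNorm_kernelOp, hsNorm_kernelOp, ← ofReal_norm, ← ofReal_norm,
    ← ENNReal.ofReal_mul' (norm_nonneg _)]
  exact ENNReal.ofReal_le_ofReal (Lp.norm_le_mul_norm_of_ae_le_mul kernel_le)

end Kernel

end Cutoff

section LocalEstimate

variable {α : Type*} [MeasurableSpace α] {μ : Measure α} {B S : Set α}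

theorem mulL_eq_smul_one {φ : Lp ℂ ∞ μ} {c : ℂ} (h : ∀ᵐ a ∂μ, φ a = c) : mulL μ φ = c • 1 := by
  refine ContinuousLinearMap.ext fun x => mulL_apply_eq ?_
  filter_upwards [h, Lp.coeFn_smul c x] with a ha hx
  rw [smul_apply, one_apply_eq_self, hx, ha, Pi.smul_apply, smul_eq_mul]

theorem cutCommutator_eq_of_ae_sub_const (hB : MeasurableSet B) {φ φ' : Lp ℂ ∞ μ} {c : ℂ}
    (h : ∀ᵐ a ∂μ, φ' a = φ a - c) (T : Lp ℂ 2 μ →L[ℂ] Lp ℂ 2 μ) :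
    cutCommutator hB φ T = cutCommutator hB φ' T := by
  have scalar : mulL μ (φ - φ') = c • 1 := by
    refine mulL_eq_smul_one ?_
    filter_upwards [h, Lp.coeFn_sub φ φ'] with a h₁ h₂
    rw [h₂, Pi.sub_apply, h₁, sub_sub_cancel]
  rw [map_sub, sub_eq_iff_eq_add] at scalar
  rw [cutCommutator, cutCommutator, scalar, add_mul, mul_add, smul_one_mul, mul_smul_one,
    add_sub_add_left_eq_sub]

theorem cutCommutator_apply (hB : MeasurableSet B) (φ : Lp ℂ ∞ μ) (T : Lp ℂ 2 μ →L[ℂ] Lp ℂ 2 μ)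
    {x : Lp ℂ 2 μ} (hx : ∀ᵐ a ∂μ, a ∉ B → x a = 0) :
    cutCommutator hB φ T x
      = mulL μ φ (cutoff μ hB (T x)) - cutoff μ hB (T (mulL μ φ x)) := by
  have comm : cutoff μ hB (mulL μ φ (T x)) = mulL μ φ (cutoff μ hB (T x)) :=
    (DFunLike.congr_fun (mulL_commute_cutoff φ hB).eq (T x)).symm
  change cutoff μ hB (mulL μ φ (T (cutoff μ hB x)) - T (mulL μ φ (cutoff μ hB x))) = _
  rw [cutoff_apply_eq_self hB hx, map_sub, comm]

theorem norm_cutCommutator_apply_le_of_ae_le (hB : MeasurableSet B) {φ ψ : Lp ℂ ∞ μ}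
    {T : Lp ℂ 2 μ →L[ℂ] Lp ℂ 2 μ} {C r : ℝ} {x : Lp ℂ 2 μ} (hC : 0 ≤ C) (hSB : S ⊆ B)
    (hx : ∀ᵐ a ∂μ, a ∉ S → x a = 0) (hle : ∀ᵐ a ∂μ, a ∈ B → ‖φ a‖ ≤ C * ‖ψ a‖)
    (hr : ∀ᵐ a ∂μ, a ∈ S → ‖ψ a‖ ≤ r) :
    ‖cutCommutator hB φ T x‖ ≤ C * (‖cutCommutator hB ψ T x‖ + 2 * (‖T‖ * (r * ‖x‖))) := by
  let P := cutoff μ hB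
  have hxB : ∀ᵐ a ∂μ, a ∉ B → x a = 0 := hx.mono fun a ha haB => ha fun haS => haB (hSB haS)
  have norm_PT_le (y : Lp ℂ 2 μ) : ‖P (T y)‖ ≤ ‖T‖ * ‖y‖ :=
    (P.le_of_opNorm_le (norm_cutoff_le_one hB) _).trans ((one_mul _).trans_le (T.le_opNorm y))
  have norm_ψx_le : ‖mulL μ ψ x‖ ≤ r * ‖x‖ := norm_mulL_apply_le_mul_norm hx hr
  have norm_φx_le : ‖mulL μ φ x‖ ≤ C * (r * ‖x‖) :=
    (norm_mulL_apply_le hxB hle).trans (by gcongr)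
  have norm_ψPTx_le : ‖mulL μ ψ (P (T x))‖ ≤ ‖cutCommutator hB ψ T x‖ + ‖T‖ * (r * ‖x‖) := by
    rw [cutCommutator_apply hB ψ T hxB]
    refine (norm_le_norm_sub_add _ (P (T (mulL μ ψ x)))).trans (add_le_add le_rfl ?_)
    exact (norm_PT_le _).trans (by gcongr)
  have norm_φPTx_le : ‖mulL μ φ (P (T x))‖ ≤ C * ‖mulL μ ψ (P (T x))‖ :=
    norm_mulL_apply_le (cutoff_apply_ae_eq_zero hB (T x)) hle
  calc ‖cutCommutator hB φ T x‖
      ≤ ‖mulL μ φ (P (T x))‖ + ‖P (T (mulL μ φ x))‖ := by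
        rw [cutCommutator_apply hB φ T hxB]
        exact norm_sub_le _ _
    _ ≤ C * (‖cutCommutator hB ψ T x‖ + ‖T‖ * (r * ‖x‖)) + ‖T‖ * (C * (r * ‖x‖)) := by
        refine add_le_add (norm_φPTx_le.trans ?_) ((norm_PT_le _).trans ?_) <;> gcongr
    _ = C * (‖cutCommutator hB ψ T x‖ + 2 * (‖T‖ * (r * ‖x‖))) := by ring

theorem norm_cutCommutator_apply_le (hB : MeasurableSet B) {φ ψ : Lp ℂ ∞ μ}
    {T : Lp ℂ 2 μ →L[ℂ] Lp ℂ 2 μ} {C r : ℝ} {x : Lp ℂ 2 μ} {c d : ℂ} (hC : 0 ≤ C) (hSB : S ⊆ B)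
    (hx : ∀ᵐ a ∂μ, a ∉ S → x a = 0) (hle : ∀ᵐ a ∂μ, a ∈ B → ‖φ a - c‖ ≤ C * ‖ψ a - d‖)
    (hr : ∀ᵐ a ∂μ, a ∈ S → ‖ψ a - d‖ ≤ r) :
    ‖cutCommutator hB φ T x‖ ≤ C * (‖cutCommutator hB ψ T x‖ + 2 * (‖T‖ * (r * ‖x‖))) := by
  have recentre (φ : Lp ℂ ∞ μ) (c : ℂ) :
      ∀ᵐ a ∂μ, (φ - (memLp_top_const c).toLp _ : Lp ℂ ∞ μ) a = φ a - c := by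
    filter_upwards [Lp.coeFn_sub φ ((memLp_top_const c).toLp _),
      (memLp_top_const c).coeFn_toLp (μ := μ)] with a h₁ h₂
    rw [h₁, Pi.sub_apply, h₂]
  rw [cutCommutator_eq_of_ae_sub_const hB (recentre φ c),
    cutCommutator_eq_of_ae_sub_const hB (recentre ψ d)]
  refine norm_cutCommutator_apply_le_of_ae_le hB hC hSB hx ?_ ?_
  · filter_upwards [hle, recentre φ c, recentre ψ d] with a ha h₁ h₂
    rwa [h₁, h₂]
  · filter_upwards [hr, recentre ψ d] with a ha h₁
    rwa [h₁]

end LocalEstimate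

section Cells

variable {α : Type*} [MeasurableSpace α] {μ : Measure α}

/-- The unit vector of `L²(μ)` proportional to the indicator of `s` (the zero vector if `s` is a
null set). -/
def unitIndicator {s : Set α} (hs : MeasurableSet s) (hμs : μ s ≠ ∞) : Lp ℂ 2 μ :=
  ((‖indicatorConstLp 2 hs hμs (1 : ℂ)‖ : ℂ)⁻¹) • indicatorConstLp 2 hs hμs 1

theorem norm_indicatorConstLp_one_ne_zero {s : Set α} (hs : MeasurableSet s) (hμs : μ s ≠ ∞)
    (hμs₀ : μ s ≠ 0) : ‖indicatorConstLp 2 hs hμs (1 : ℂ)‖ ≠ 0 := by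
  rw [norm_indicatorConstLp two_ne_zero ENNReal.ofNat_ne_top, norm_one, one_mul]
  exact (Real.rpow_pos_of_pos (ENNReal.toReal_pos hμs₀ hμs) _).ne'

theorem smul_unitIndicator {s : Set α} (hs : MeasurableSet s) (hμs : μ s ≠ ∞) (hμs₀ : μ s ≠ 0) :
    (‖indicatorConstLp 2 hs hμs (1 : ℂ)‖ : ℂ) • unitIndicator hs hμs
      = indicatorConstLp 2 hs hμs 1 :=
  smul_inv_smul₀ (Complex.ofReal_ne_zero.2 (norm_indicatorConstLp_one_ne_zero hs hμs hμs₀)) _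

theorem unitIndicator_ae_eq_zero {s : Set α} (hs : MeasurableSet s) (hμs : μ s ≠ ∞) :
    ∀ᵐ a ∂μ, a ∉ s → unitIndicator hs hμs a = 0 := by
  filter_upwards [Lp.coeFn_smul ((‖indicatorConstLp 2 hs hμs (1 : ℂ)‖ : ℂ)⁻¹)
    (indicatorConstLp 2 hs hμs (1 : ℂ)), indicatorConstLp_coeFn (hs := hs) (hμs := hμs) (p := 2)
    (c := (1 : ℂ))] with a h₁ h₂ ha
  exact h₁.trans (by rw [Pi.smul_apply, h₂, Set.indicator_of_notMem ha, smul_zero])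

theorem orthonormal_unitIndicator {ι : Type*} {s : ι → Set α} (hs : ∀ i, MeasurableSet (s i))
    (hμs : ∀ i, μ (s i) ≠ ∞) (hμs₀ : ∀ i, μ (s i) ≠ 0) (hd : Pairwise (Function.onFun Disjoint s)) :
    Orthonormal ℂ fun i => unitIndicator (hs i) (hμs i) := by
  refine ⟨fun i => norm_smul_inv_norm (𝕜 := ℂ)
    (norm_ne_zero_iff.1 (norm_indicatorConstLp_one_ne_zero (hs i) (hμs i) (hμs₀ i))),
    fun i j hij => ?_⟩
  simp only [unitIndicator, inner_smul_left, inner_smul_right,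
    L2.inner_indicatorConstLp_one_indicatorConstLp_one, (hd hij).inter_eq, measureReal_empty,
    RCLike.ofReal_zero, mul_zero]

end Cells

theorem orthonormal_basisSpan {ι E : Type*} [NormedAddCommGroup E] [InnerProductSpace ℂ E]
    {v : ι → E} (hv : Orthonormal ℂ v) :
    Orthonormal ℂ (Module.Basis.span hv.linearIndependent) := by
  refine ⟨fun i => ?_, fun i j hij => ?_⟩
  · rw [Submodule.coe_norm, Module.Basis.span_apply, hv.1]
  · simp only [Submodule.coe_inner, Module.Basis.span_apply, hv.2 hij]

section Approximation

variable {α ι : Type*} [PseudoMetricSpace α] [MeasurableSpace α] {μ : Measure α} {B : Set α}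
  {s : ι → Set α} {δ : ℝ}

/-- The sets `s i` partition `B`, up to a null set, into non-null sets of finite measure and of
diameter at most `δ`. -/
structure IsCellPartition (μ : Measure α) (B : Set α) (δ : ℝ) (s : ι → Set α) : Prop where
  measurableSet : ∀ i, MeasurableSet (s i)
  measure_ne_top : ∀ i, μ (s i) ≠ ∞
  measure_ne_zero : ∀ i, μ (s i) ≠ 0
  pairwise_disjoint : Pairwise (Function.onFun Disjoint s)
  subset : ∀ i, s i ⊆ B
  ae_mem : ∀ᵐ a ∂μ, a ∈ B → ∃ i, a ∈ s i
  dist_le : ∀ i, ∀ a ∈ s i, ∀ b ∈ s i, dist a b ≤ δ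

namespace IsCellPartition

/-- The unit vectors of `L²(μ)` supported in and constant on the cells of a partition. -/
def cellVector (h : IsCellPartition μ B δ s) (i : ι) : Lp ℂ 2 μ :=
  unitIndicator (h.measurableSet i) (h.measure_ne_top i)

theorem orthonormal_cellVector (h : IsCellPartition μ B δ s) : Orthonormal ℂ h.cellVector :=
  orthonormal_unitIndicator h.measurableSet h.measure_ne_top h.measure_ne_zero h.pairwise_disjoint

/-- The step functions on the cells of a partition. -/
abbrev stepSpace (h : IsCellPartition μ B δ s) : Submodule ℂ (Lp ℂ 2 μ) :=
  Submodule.span ℂ (Set.range h.cellVector)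

instance [Finite ι] (h : IsCellPartition μ B δ s) : FiniteDimensional ℂ h.stepSpace :=
  FiniteDimensional.span_of_finite ℂ (Set.finite_range _)

/-- The unit vectors of the cells as an orthonormal basis of the step functions. -/
def cellBasis [Fintype ι] (h : IsCellPartition μ B δ s) : OrthonormalBasis ι ℂ h.stepSpace :=
  (Module.Basis.span h.orthonormal_cellVector.linearIndependent).toOrthonormalBasis
    (orthonormal_basisSpan h.orthonormal_cellVector)

theorem coe_cellBasis [Fintype ι] (h : IsCellPartition μ B δ s) (i : ι) :
    (h.cellBasis i : Lp ℂ 2 μ) = h.cellVector i := by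
  rw [cellBasis, Module.Basis.coe_toOrthonormalBasis, Module.Basis.span_apply]

theorem indicatorConstLp_mem_stepSpace (h : IsCellPartition μ B δ s) (i : ι) :
    indicatorConstLp 2 (h.measurableSet i) (h.measure_ne_top i) 1 ∈ h.stepSpace := by
  rw [← smul_unitIndicator _ _ (h.measure_ne_zero i)]
  exact Submodule.smul_mem _ _ (Submodule.subset_span ⟨i, rfl⟩)

theorem exists_mem_stepSpace_norm_cutoff_sub_le [Finite ι] (h : IsCellPartition μ B δ s)
    (hB : MeasurableSet B) (hμB : μ B ≠ ∞) {g : α → ℂ} {G : Lp ℂ 2 μ} (hG : G =ᵐ[μ] g) {ε : ℝ}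
    (hg : ∀ a b, dist a b ≤ δ → ‖g a - g b‖ ≤ ε) :
    ∃ v ∈ h.stepSpace,
      ‖cutoff μ hB G - v‖ ≤ ε * ‖indicatorConstLp 2 hB hμB (1 : ℂ)‖ := by
  have := Fintype.ofFinite ι
  choose z hz using fun i => nonempty_of_measure_ne_zero (h.measure_ne_zero i)
  let v (i : ι) : Lp ℂ 2 μ :=
    g (z i) • indicatorConstLp 2 (h.measurableSet i) (h.measure_ne_top i) 1
  have v_coeFn (i : ι) : v i =ᵐ[μ] (s i).indicator fun _ => g (z i) := by
    filter_upwards [Lp.coeFn_smul (g (z i)) (indicatorConstLp 2 (h.measurableSet i)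
      (h.measure_ne_top i) (1 : ℂ)), indicatorConstLp_coeFn (hs := h.measurableSet i)
      (hμs := h.measure_ne_top i) (p := 2) (c := (1 : ℂ))] with a h₁ h₂
    rw [h₁, Pi.smul_apply, h₂]
    by_cases ha : a ∈ s i <;> simp [ha]
  have sum_coeFn : ∀ᵐ a ∂μ,
      (∑ i, v i : Lp ℂ 2 μ) a = ∑ i, (s i).indicator (fun _ => g (z i)) a := by
    filter_upwards [Lp.coeFn_fun_finsetSum Finset.univ v, ae_all_iff.2 v_coeFn] with a h₁ h₂
    exact h₁.trans (Finset.sum_congr rfl fun i _ => h₂ i)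
  refine ⟨∑ i, v i, Submodule.sum_mem _ fun i _ =>
    Submodule.smul_mem _ _ (h.indicatorConstLp_mem_stepSpace i), ?_⟩
  refine Lp.norm_le_mul_norm_of_ae_le_mul ?_
  filter_upwards [Lp.coeFn_sub (cutoff μ hB G) (∑ i, v i), cutoff_coeFn hB G, sum_coeFn, hG,
    h.ae_mem, indicatorConstLp_coeFn (hs := hB) (hμs := hμB) (p := 2) (c := (1 : ℂ))]
    with a h₁ h₂ h₃ h₄ h₅ h₆
  rw [h₁, Pi.sub_apply, h₂, h₃, h₆]
  by_cases ha : a ∈ B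
  · obtain ⟨i, hi⟩ := h₅ ha
    have only_cell (j : ι) (hj : j ≠ i) : (s j).indicator (fun _ => g (z j)) a = 0 :=
      Set.indicator_of_notMem (Set.disjoint_right.1 (h.pairwise_disjoint hj) hi) _
    rw [Set.indicator_of_mem ha, Set.indicator_of_mem ha, Fintype.sum_eq_single i only_cell,
      Set.indicator_of_mem hi, h₄, norm_one, mul_one]
    exact hg _ _ (h.dist_le i _ hi _ (hz i))
  · have no_cell (j : ι) : (s j).indicator (fun _ => g (z j)) a = 0 :=
      Set.indicator_of_notMem (fun hj => ha (h.subset j hj)) _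
    simp only [Set.indicator_of_notMem ha, no_cell, Finset.sum_const_zero, sub_self, norm_zero,
      mul_zero, le_refl]

end IsCellPartition

theorem norm_sub_starProjection_le {E : Type*} [NormedAddCommGroup E] [InnerProductSpace ℂ E]
    {V : Submodule ℂ E} [V.HasOrthogonalProjection] (y : E) {v : E} (hv : v ∈ V) :
    ‖y - V.starProjection y‖ ≤ ‖y - v‖ := by
  rw [V.starProjection_minimal]
  exact ciInf_le ⟨0, Set.forall_mem_range.2 fun _ => norm_nonneg _⟩ (⟨v, hv⟩ : V)

theorem tendsto_starProjection_stepSpace_cutoff [BorelSpace α] [WeaklyLocallyCompactSpace α]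
    [μ.Regular] {κ : Type*} {l : Filter κ} {ι : κ → Type*} [∀ n, Finite (ι n)]
    {s : ∀ n, ι n → Set α} {δ : κ → ℝ} (h : ∀ n, IsCellPartition μ B (δ n) (s n))
    (hδ : Tendsto δ l (𝓝 0)) (hB : MeasurableSet B) (hμB : μ B ≠ ∞) (x : Lp ℂ 2 μ) :
    Tendsto (fun n => (h n).stepSpace.starProjection (cutoff μ hB x)) l (𝓝 (cutoff μ hB x)) := by
  refine Metric.tendsto_nhds.2 fun ε hε => ?_
  let M := ‖indicatorConstLp 2 hB hμB (1 : ℂ)‖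
  obtain ⟨g, g_compact, hxg, g_cont, g_mem⟩ := (Lp.memLp x).exists_hasCompactSupport_eLpNorm_sub_le
    ENNReal.ofNat_ne_top (ENNReal.ofReal_pos.2 (half_pos hε)).ne'
  let G : Lp ℂ 2 μ := g_mem.toLp g
  have norm_sub_G_le : ‖x - G‖ ≤ ε / 2 := by
    rw [← Lp.toLp_coeFn x (Lp.memLp x), ← MemLp.toLp_sub, Lp.norm_toLp]
    exact ENNReal.toReal_le_of_le_ofReal (half_pos hε).le hxg
  have hM : 0 < M + 1 := by positivity
  obtain ⟨η, hη, hgη⟩ := Metric.uniformContinuous_iff.1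
    (g_compact.uniformContinuous_of_continuous g_cont) (ε / 2 / (M + 1)) (by positivity)
  filter_upwards [hδ.eventually_lt_const hη] with n hn
  obtain ⟨v, hv, hGv⟩ := (h n).exists_mem_stepSpace_norm_cutoff_sub_le hB hμB g_mem.coeFn_toLp
    (ε := ε / 2 / (M + 1)) fun a b hab => by
      rw [← dist_eq_norm]
      exact (hgη (hab.trans_lt hn)).le
  rw [dist_comm, dist_eq_norm]
  calc ‖cutoff μ hB x - (h n).stepSpace.starProjection (cutoff μ hB x)‖
      ≤ ‖cutoff μ hB (x - G) + (cutoff μ hB G - v)‖ := by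
        rw [map_sub, sub_add_sub_cancel]
        exact norm_sub_starProjection_le _ hv
    _ ≤ 1 * ‖x - G‖ + ε / 2 / (M + 1) * M :=
        (norm_add_le _ _).trans
          (add_le_add ((cutoff μ hB).le_of_opNorm_le (norm_cutoff_le_one hB) _) hGv)
    _ < ε / 2 + ε / 2 := by
        rw [one_mul, div_mul_eq_mul_div]
        refine add_lt_add_of_le_of_lt norm_sub_G_le ((div_lt_iff₀ hM).2 ?_)
        gcongr
        exact lt_add_one M
    _ = ε := add_halves ε

end Approximation

section Finiteness

variable {α ι : Type*} [PseudoMetricSpace α] [MeasurableSpace α] {μ : Measure α} [SigmaFinite μ]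
  {B : Set α} {φ ψ : Lp ℂ ∞ μ} {T : Lp ℂ 2 μ →L[ℂ] Lp ℂ 2 μ} {C K : ℝ}

theorem norm_cutCommutator_cellVector_le {s : ι → Set α} {δ : ℝ} (hs : IsCellPartition μ B δ s)
    (hB : MeasurableSet B) (hC : 0 ≤ C) (hK : 0 ≤ K)
    (hle : ∀ᵐ p ∂μ.prod μ, p.1 ∈ B → p.2 ∈ B → ‖φ p.1 - φ p.2‖ ≤ C * ‖ψ p.1 - ψ p.2‖)
    (hψ : ∀ᵐ p ∂μ.prod μ, p.1 ∈ B → p.2 ∈ B → ‖ψ p.1 - ψ p.2‖ ≤ K * dist p.1 p.2) (i : ι) :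
    ‖cutCommutator hB φ T (hs.cellVector i)‖
      ≤ C * (‖cutCommutator hB ψ T (hs.cellVector i)‖ + 2 * (‖T‖ * (K * δ))) := by
  obtain ⟨z, hz, z_le, z_lip⟩ := ((frequently_ae_mem_iff.2 (hs.measure_ne_zero i)).and_eventually
    ((Measure.ae_ae_of_ae_prod hle).and (Measure.ae_ae_of_ae_prod hψ))).exists
  have le_at_z : ∀ᵐ a ∂μ, a ∈ B → ‖φ a - φ z‖ ≤ C * ‖ψ a - ψ z‖ := by
    filter_upwards [z_le] with a ha haB
    rw [norm_sub_rev, norm_sub_rev (ψ a)]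
    exact ha (hs.subset i hz) haB
  have small_near_z : ∀ᵐ a ∂μ, a ∈ s i → ‖ψ a - ψ z‖ ≤ K * δ := by
    filter_upwards [z_lip] with a ha has
    rw [norm_sub_rev]
    refine (ha (hs.subset i hz) (hs.subset i has)).trans ?_
    gcongr
    exact hs.dist_le i z hz a has
  simpa only [hs.orthonormal_cellVector.1 i, mul_one] using norm_cutCommutator_apply_le hB hC
    (hs.subset i) (unitIndicator_ae_eq_zero _ _) le_at_z small_near_z
    (T := T) (x := hs.cellVector i)

theorem hsNorm_cutCommutator_mul_starProjection_sq_le [Fintype ι] {s : ι → Set α} {δ : ℝ}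
    (hs : IsCellPartition μ B δ s) (hB : MeasurableSet B) (hC : 0 ≤ C) (hK : 0 ≤ K)
    (hle : ∀ᵐ p ∂μ.prod μ, p.1 ∈ B → p.2 ∈ B → ‖φ p.1 - φ p.2‖ ≤ C * ‖ψ p.1 - ψ p.2‖)
    (hψ : ∀ᵐ p ∂μ.prod μ, p.1 ∈ B → p.2 ∈ B → ‖ψ p.1 - ψ p.2‖ ≤ K * dist p.1 p.2) :
    hsNorm (cutCommutator hB φ T * hs.stepSpace.starProjection) ^ 2
      ≤ ENNReal.ofReal (2 * C ^ 2) * (hsNorm (cutCommutator hB ψ T) ^ 2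
        + ENNReal.ofReal ((2 * ‖T‖ * K) ^ 2 * (Fintype.card ι * δ ^ 2))) := by
  have cell_sq_le (i : ι) : ‖cutCommutator hB φ T (hs.cellVector i)‖ ^ 2
      ≤ 2 * C ^ 2 * (‖cutCommutator hB ψ T (hs.cellVector i)‖ ^ 2
        + (2 * (‖T‖ * (K * δ))) ^ 2) := by
    refine (pow_le_pow_left₀ (norm_nonneg _)
      (norm_cutCommutator_cellVector_le hs hB hC hK hle hψ i) 2).trans ?_
    rw [mul_pow, mul_comm 2 (C ^ 2), mul_assoc]
    exact mul_le_mul_of_nonneg_left add_sq_le (sq_nonneg C)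
  have card_sum : ∑ _i : ι, ENNReal.ofReal ((2 * (‖T‖ * (K * δ))) ^ 2)
      = ENNReal.ofReal ((2 * ‖T‖ * K) ^ 2 * (Fintype.card ι * δ ^ 2)) := by
    rw [Finset.sum_const, Finset.card_univ, ← ENNReal.ofReal_nsmul, nsmul_eq_mul]
    ring_nf
  calc hsNorm (cutCommutator hB φ T * hs.stepSpace.starProjection) ^ 2
      = ∑ i, ‖cutCommutator hB φ T (hs.cellVector i)‖ₑ ^ 2 := by
        simp only [hsNorm_mul_starProjection_sq hs.cellBasis, hs.coe_cellBasis]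
    _ ≤ ∑ i, ENNReal.ofReal (2 * C ^ 2) * (‖cutCommutator hB ψ T (hs.cellVector i)‖ₑ ^ 2
          + ENNReal.ofReal ((2 * (‖T‖ * (K * δ))) ^ 2)) := by
        gcongr with i
        simp only [← ofReal_norm, ← ENNReal.ofReal_pow (norm_nonneg _)]
        rw [← ENNReal.ofReal_add (by positivity) (by positivity),
          ← ENNReal.ofReal_mul (by positivity)]
        exact ENNReal.ofReal_le_ofReal (cell_sq_le i)
    _ ≤ _ := by
        rw [← Finset.mul_sum, Finset.sum_add_distrib, card_sum]
        gcongr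
        simpa only [hs.coe_cellBasis] using
          sum_enorm_apply_sq_le_hsNorm_sq hs.cellBasis (cutCommutator hB ψ T)

/-- `B` has partitions of arbitrarily small mesh `δ` into at most `D / δ ^ 2` cells, as bounded
subsets of the plane do. -/
def HasPlanarPartitions (μ : Measure α) (B : Set α) (D : ℝ) : Prop :=
  ∀ ε > 0, ∃ δ ≥ 0, δ ≤ ε ∧ ∃ (N : ℕ) (s : Fin N → Set α),
    IsCellPartition μ B δ s ∧ N * δ ^ 2 ≤ D

theorem hsNorm_cutCommutator_ne_top [BorelSpace α] [WeaklyLocallyCompactSpace α] [μ.Regular]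
    {D : ℝ} (hμ : HasPlanarPartitions μ B D) (hB : MeasurableSet B) (hμB : μ B ≠ ∞)
    (hC : 0 ≤ C) (hK : 0 ≤ K)
    (hle : ∀ᵐ p ∂μ.prod μ, p.1 ∈ B → p.2 ∈ B → ‖φ p.1 - φ p.2‖ ≤ C * ‖ψ p.1 - ψ p.2‖)
    (hψ : ∀ᵐ p ∂μ.prod μ, p.1 ∈ B → p.2 ∈ B → ‖ψ p.1 - ψ p.2‖ ≤ K * dist p.1 p.2)
    (hfin : hsNorm (cutCommutator hB ψ T) ≠ ∞) : hsNorm (cutCommutator hB φ T) ≠ ∞ := by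
  choose δ hδ₀ hδ N s hs hN using fun n : ℕ => hμ (1 / (n + 1)) Nat.one_div_pos_of_nat
  have mesh_tendsto : Tendsto δ atTop (𝓝 0) :=
    squeeze_zero hδ₀ hδ tendsto_one_div_add_atTop_nhds_zero_nat
  let A := cutCommutator hB φ T
  let M : ℝ≥0∞ := ENNReal.ofReal (2 * C ^ 2) * (hsNorm (cutCommutator hB ψ T) ^ 2
    + ENNReal.ofReal ((2 * ‖T‖ * K) ^ 2 * D))
  have hM : M ≠ ∞ := ENNReal.mul_ne_top ENNReal.ofReal_ne_top
    (ENNReal.add_ne_top.2 ⟨ENNReal.pow_ne_top hfin, ENNReal.ofReal_ne_top⟩)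
  have bounded (n : ℕ) :
      hsNorm (A * (hs n).stepSpace.starProjection * cutoff μ hB) ^ 2 ≤ M := by
    refine (pow_le_pow_left' (hsNorm_mul_le_of_norm_le_one (norm_cutoff_le_one hB)) 2).trans
      ((hsNorm_cutCommutator_mul_starProjection_sq_le (hs n) hB hC hK hle hψ).trans ?_)
    simp only [Fintype.card_fin, M]
    gcongr
    exact hN n
  have strongly (x : Lp ℂ 2 μ) :
      Tendsto (fun n => (A * (hs n).stepSpace.starProjection * cutoff μ hB) x) atTop (𝓝 (A x)) := by
    have A_cutoff : A (cutoff μ hB x) = A x := by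
      change (A * cutoff μ hB) x = A x
      simp only [A, cutCommutator, mul_assoc, cutoff_mul_self]
    rw [← A_cutoff]
    exact (A.continuous.tendsto _).comp
      (tendsto_starProjection_stepSpace_cutoff hs mesh_tendsto hB hμB x)
  have sqrt_bound : hsNorm A ≤ M ^ (1 / 2 : ℝ) := by
    refine hsNorm_le_of_tendsto strongly (.of_forall fun n => ?_)
    rw [one_div, ENNReal.le_rpow_inv_iff two_pos, ENNReal.rpow_two]
    exact bounded n
  exact ne_top_of_le_ne_top (ENNReal.rpow_ne_top_of_nonneg (by norm_num) hM) sqrt_bound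

end Finiteness

section Grid

theorem exists_isCellPartition_of_fibers {α κ : Type*} [PseudoMetricSpace α] [MeasurableSpace α]
    [MeasurableSpace κ] [MeasurableSingletonClass κ] {μ : Measure α} {B : Set α} {δ : ℝ} {q : α → κ}
    (hq : Measurable q) {I : Finset κ} (hqI : ∀ a ∈ B, q a ∈ I) (hB : MeasurableSet B)
    (hμB : μ B ≠ ∞) (hδ : ∀ a ∈ B, ∀ b ∈ B, q a = q b → dist a b ≤ δ) :
    ∃ (N : ℕ) (s : Fin N → Set α), IsCellPartition μ B δ s ∧ N ≤ I.card := by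
  classical
  let cell (k : κ) : Set α := B ∩ q ⁻¹' {k}
  let J := I.filter fun k => μ (cell k) ≠ 0
  have partition : IsCellPartition μ B δ fun k : J => cell k :=
    { measurableSet := fun k => hB.inter (hq (measurableSet_singleton _))
      measure_ne_top := fun k => measure_ne_top_of_subset Set.inter_subset_left hμB
      measure_ne_zero := fun k => (Finset.mem_filter.1 k.2).2
      pairwise_disjoint := fun k l hkl => Set.disjoint_left.2 fun a ha hb =>
        hkl (Subtype.ext (ha.2.symm.trans hb.2))
      subset := fun k => Set.inter_subset_left
      ae_mem := by
        have not_mem_null : ∀ᵐ a ∂μ, ∀ k ∈ I, μ (cell k) = 0 → a ∉ cell k := by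
          refine (Finset.eventually_all I).2 fun k _ => ?_
          by_cases hk : μ (cell k) = 0
          · filter_upwards [measure_eq_zero_iff_ae_notMem.1 hk] with a ha _ using ha
          · exact .of_forall fun a h => absurd h hk
        filter_upwards [not_mem_null] with a ha haB
        refine ⟨⟨q a, Finset.mem_filter.2 ⟨hqI a haB, fun h => ha _ (hqI a haB) h ⟨haB, rfl⟩⟩⟩,
          haB, rfl⟩
      dist_le := fun k a ha b hb => hδ a ha.1 b hb.1 (ha.2.trans hb.2.symm) }
  refine ⟨J.card, fun j => cell (J.equivFin.symm j), ?_, Finset.card_filter_le _ _⟩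
  exact
    { measurableSet := fun j => partition.measurableSet _
      measure_ne_top := fun j => partition.measure_ne_top _
      measure_ne_zero := fun j => partition.measure_ne_zero _
      pairwise_disjoint := partition.pairwise_disjoint.comp_of_injective J.equivFin.symm.injective
      subset := fun j => partition.subset _
      ae_mem := partition.ae_mem.mono fun a ha haB => J.equivFin.symm.surjective.exists.1 (ha haB)
      dist_le := fun j => partition.dist_le _ }

theorem abs_sub_le_inv_of_floor_eq {x y c : ℝ} (hc : 0 < c) (h : ⌊c * x⌋ = ⌊c * y⌋) :
    |x - y| ≤ c⁻¹ := by
  have key := (Int.abs_sub_lt_one_of_floor_eq_floor h).le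
  rwa [← mul_sub, abs_mul, abs_of_pos hc, mul_comm, ← le_div_iff₀ hc, one_div] at key

theorem floor_mul_mem_Icc {x : ℝ} {R n : ℕ} (h : |x| ≤ R) :
    ⌊(n : ℝ) * x⌋ ∈ Finset.Icc (-(n * R : ℤ)) (n * R) := by
  obtain ⟨h₁, h₂⟩ := abs_le.1 h
  refine Finset.mem_Icc.2 ⟨Int.le_floor.2 ?_, (Int.floor_le_iff (α := ℝ)).2 ?_⟩
  · push_cast
    rw [← mul_neg]
    gcongr
  · push_cast
    exact lt_add_of_le_of_pos (by gcongr) one_pos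

theorem hasPlanarPartitions_of_isBounded {μ : Measure ℂ} [IsFiniteMeasureOnCompacts μ] {B : Set ℂ}
    (hB : MeasurableSet B) (hb : Bornology.IsBounded B) : ∃ D, HasPlanarPartitions μ B D := by
  obtain ⟨r, hr⟩ := hb.exists_norm_le
  obtain ⟨R, hrR⟩ := exists_nat_ge r
  refine ⟨4 * (2 * (R : ℝ) + 1) ^ 2, fun ε hε => ?_⟩
  obtain ⟨n, hn⟩ := exists_nat_gt (max 1 (2 / ε))
  have one_le_n : 1 ≤ (n : ℝ) := (le_max_left _ _).trans hn.le
  have n_pos : 0 < (n : ℝ) := one_pos.trans_le one_le_n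
  let q (z : ℂ) : ℤ × ℤ := (⌊n * z.re⌋, ⌊n * z.im⌋)
  let I := Finset.Icc (-(n * R : ℤ)) (n * R)
  have card_I : (I.card : ℝ) = 2 * n * R + 1 := by
    rw [Int.card_Icc, ← Int.cast_natCast, sub_neg_eq_add,
      Int.toNat_of_nonneg (by positivity)]
    push_cast
    ring
  obtain ⟨N, s, hs, hN⟩ := exists_isCellPartition_of_fibers (μ := μ) (δ := 2 / n) (q := q)
    (I := I ×ˢ I) (by fun_prop)
    (fun z hz => Finset.mem_product.2
      ⟨floor_mul_mem_Icc ((Complex.abs_re_le_norm z).trans ((hr z hz).trans hrR)),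
        floor_mul_mem_Icc ((Complex.abs_im_le_norm z).trans ((hr z hz).trans hrR))⟩)
    hB hb.measure_lt_top.ne fun z _ w _ hzw => by
      rw [Prod.mk.injEq] at hzw
      rw [dist_eq_norm, ← one_add_one_eq_two, add_div, one_div]
      exact (Complex.norm_le_abs_re_add_abs_im _).trans (add_le_add
        (abs_sub_le_inv_of_floor_eq n_pos hzw.1) (abs_sub_le_inv_of_floor_eq n_pos hzw.2))
  refine ⟨2 / n, by positivity, ?_, N, s, hs, ?_⟩
  · exact ((div_lt_comm₀ hε n_pos).1 ((le_max_right _ _).trans_lt hn)).le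
  · calc (N : ℝ) * (2 / n) ^ 2 ≤ (2 * n * R + 1) ^ 2 * (2 / n : ℝ) ^ 2 := by
          gcongr
          rw [Finset.card_product] at hN
          rw [← card_I, sq]
          exact_mod_cast hN
      _ ≤ (2 * n * R + n) ^ 2 * (2 / n : ℝ) ^ 2 := by gcongr
      _ = 4 * (2 * (R : ℝ) + 1) ^ 2 := by
          field_simp
          ring

end Grid

section Exhaustion

variable {α : Type*} [MeasurableSpace α] {μ : Measure α} {B : ℕ → Set α}

theorem enorm_sq_eq_lintegral (x : Lp ℂ 2 μ) : ‖x‖ₑ ^ 2 = ∫⁻ a, ‖x a‖ₑ ^ 2 ∂μ := by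
  simpa [← Lp.enorm_def] using
    eLpNorm_nnreal_pow_eq_lintegral (f := x) (μ := μ) (p := 2) two_ne_zero

theorem tendsto_cutoff (hB : ∀ n, MeasurableSet (B n)) (h : ∀ᵐ a ∂μ, ∀ᶠ n in atTop, a ∈ B n)
    (x : Lp ℂ 2 μ) : Tendsto (fun n => cutoff μ (hB n) x) atTop (𝓝 x) := by
  have sub_coeFn (n : ℕ) : (cutoff μ (hB n) x - x : Lp ℂ 2 μ)
      =ᵐ[μ] fun a => (B n).indicator x a - x a := by
    filter_upwards [Lp.coeFn_sub (cutoff μ (hB n) x) x, cutoff_coeFn (hB n) x] with a h₁ h₂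
    rw [h₁, Pi.sub_apply, h₂]
  have sq_tendsto : Tendsto (fun n => ‖cutoff μ (hB n) x - x‖ₑ ^ 2) atTop (𝓝 0) := by
    simp only [enorm_sq_eq_lintegral]
    rw [← lintegral_zero (μ := μ)]
    refine tendsto_lintegral_of_dominated_convergence' (fun a => ‖x a‖ₑ ^ 2)
      (fun n => (Lp.aestronglyMeasurable _).enorm.pow_const 2) (fun n => ?_) ?_ ?_
    · filter_upwards [sub_coeFn n] with a ha
      rw [ha]
      by_cases haB : a ∈ B n <;> simp [haB]
    · rw [← enorm_sq_eq_lintegral]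
      exact ENNReal.pow_ne_top enorm_ne_top
    · filter_upwards [h, ae_all_iff.2 sub_coeFn] with a hev ha
      refine tendsto_const_nhds.congr' ?_
      filter_upwards [hev] with n hn
      rw [ha, Set.indicator_of_mem hn, sub_self, enorm_zero, zero_pow two_ne_zero]
  rw [tendsto_iff_edist_tendsto_0]
  simp only [edist_eq_enorm_sub]
  simpa only [ENNReal.pow_rpow_inv_natCast two_ne_zero, ENNReal.zero_rpow_of_pos, inv_pos,
    Nat.cast_pos, two_pos] using sq_tendsto.ennrpow_const ((2 : ℕ) : ℝ)⁻¹

theorem hsNorm_le_of_forall_cutoff {X : Lp ℂ 2 μ →L[ℂ] Lp ℂ 2 μ} {C : ℝ≥0∞}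
    (hB : ∀ n, MeasurableSet (B n)) (h : ∀ᵐ a ∂μ, ∀ᶠ n in atTop, a ∈ B n)
    (hX : ∀ n, hsNorm (cutoff μ (hB n) * X * cutoff μ (hB n)) ≤ C) : hsNorm X ≤ C := by
  refine hsNorm_le_of_tendsto (l := atTop) (fun x => ?_) (.of_forall hX)
  have X_tendsto := (X.continuous.tendsto x).comp (tendsto_cutoff hB h x)
  have norm_le (n : ℕ) : ‖cutoff μ (hB n) (X (cutoff μ (hB n) x)) - cutoff μ (hB n) (X x)‖
      ≤ ‖X (cutoff μ (hB n) x) - X x‖ := by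
    rw [← map_sub]
    exact (ContinuousLinearMap.le_of_opNorm_le _ (norm_cutoff_le_one (hB n)) _).trans_eq
      (one_mul _)
  have sub_tendsto := squeeze_zero_norm norm_le (tendsto_iff_norm_sub_tendsto_zero.1 X_tendsto)
  have sum_tendsto := sub_tendsto.add (tendsto_cutoff hB h (X x))
  rw [zero_add] at sum_tendsto
  exact sum_tendsto.congr fun n => sub_add_cancel _ _

theorem hsNorm_cutCommutator_le_hsNorm {B : Set α} (hB : MeasurableSet B) (φ : Lp ℂ ∞ μ)
    (T : Lp ℂ 2 μ →L[ℂ] Lp ℂ 2 μ) :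
    hsNorm (cutCommutator hB φ T) ≤ hsNorm (mulL μ φ * T - T * mulL μ φ) := by
  refine (hsNorm_mul_le_of_norm_le_one (norm_cutoff_le_one hB)).trans
    ((hsNorm_mul_le _ _).trans (mul_le_of_le_one_left' ?_))
  rw [← ofReal_norm]
  exact ENNReal.ofReal_le_one.2 (norm_cutoff_le_one hB)

end Exhaustion

section Domination

variable {μ : Measure ℂ} [IsLocallyFiniteMeasure μ] {B : Set ℂ} {φ ψ : Lp ℂ ∞ μ}
  {T : Lp ℂ 2 μ →L[ℂ] Lp ℂ 2 μ} {C K ε : ℝ}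

theorem hsNorm_cutCommutator_le (hB : MeasurableSet B) (hb : Bornology.IsBounded B)
    (hC : 0 < C) (hK : 0 ≤ K)
    (hle : ∀ᵐ p ∂μ.prod μ, p.1 ∈ B → p.2 ∈ B → ‖φ p.1 - φ p.2‖ ≤ C * ‖ψ p.1 - ψ p.2‖)
    (hψ : ∀ᵐ p ∂μ.prod μ, p.1 ∈ B → p.2 ∈ B → ‖ψ p.1 - ψ p.2‖ ≤ K * dist p.1 p.2)
    (hne : ∀ᵐ p ∂μ.prod μ, p.1 ∈ B → p.2 ∈ B → ψ p.1 ≠ ψ p.2) :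
    hsNorm (cutCommutator hB φ T) ≤ ENNReal.ofReal C * hsNorm (cutCommutator hB ψ T) := by
  by_cases hfin : hsNorm (cutCommutator hB ψ T) = ∞
  · rw [hfin, ENNReal.mul_top (ENNReal.ofReal_pos.2 hC).ne']
    exact le_top
  · obtain ⟨D, hD⟩ := hasPlanarPartitions_of_isBounded (μ := μ) hB hb
    exact hsNorm_cutCommutator_le_of_ne_top hB hC.le
      (hsNorm_cutCommutator_ne_top hD hB hb.measure_lt_top.ne hC.le hK hle hψ hfin) hfin hle hne

theorem ae_fst_ne_snd [NullSingletonClass μ] : ∀ᵐ p ∂μ.prod μ, p.1 ≠ p.2 := by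
  refine (Measure.ae_prod_iff_ae_ae (by measurability)).2 (.of_forall fun s => ?_)
  simp [ae_iff]

theorem hsNorm_cutCommutator_le_of_norm_sub_sub_le [NullSingletonClass μ] (hB : MeasurableSet B)
    (hb : Bornology.IsBounded B) (hε₀ : 0 ≤ ε) (hε : ε < 1)
    (hφ : ∀ᵐ p ∂μ.prod μ, ‖φ p.1 - φ p.2‖ ≤ ‖p.1 - p.2‖)
    (hψ : ∀ᵐ p ∂μ.prod μ, p.1 ∈ B → p.2 ∈ B →
      ‖(ψ p.1 - ψ p.2) - (p.1 - p.2)‖ ≤ ε * ‖p.1 - p.2‖) :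
    hsNorm (cutCommutator hB φ T)
      ≤ ENNReal.ofReal (1 - ε)⁻¹ * hsNorm (cutCommutator hB ψ T) := by
  have ψ_expands : ∀ᵐ p ∂μ.prod μ, p.1 ∈ B → p.2 ∈ B →
      (1 - ε) * ‖p.1 - p.2‖ ≤ ‖ψ p.1 - ψ p.2‖ := by
    filter_upwards [hψ] with p hp h₁ h₂
    linarith [hp h₁ h₂, norm_sub_norm_le (p.1 - p.2) (ψ p.1 - ψ p.2),
      norm_sub_rev (p.1 - p.2) (ψ p.1 - ψ p.2)]
  refine hsNorm_cutCommutator_le hB hb (K := 1 + ε) (inv_pos.2 (sub_pos.2 hε)) (by positivity)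
    ?_ ?_ ?_
  · filter_upwards [hφ, ψ_expands] with p hp hp' h₁ h₂
    exact hp.trans ((le_inv_mul_iff₀ (sub_pos.2 hε)).2 (hp' h₁ h₂))
  · filter_upwards [hψ] with p hp h₁ h₂
    rw [dist_eq_norm]
    linarith [hp h₁ h₂, norm_sub_norm_le (ψ p.1 - ψ p.2) (p.1 - p.2)]
  · filter_upwards [ψ_expands, ae_fst_ne_snd (μ := μ)] with p hp hne h₁ h₂
    have : 0 < ‖p.1 - p.2‖ := norm_pos_iff.2 (sub_ne_zero.2 hne)
    have := (mul_pos (sub_pos.2 hε) this).trans_le (hp h₁ h₂)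
    exact sub_ne_zero.1 (norm_pos_iff.1 this)

end Domination

section Lipschitz

variable {Ω : Set ℂ} {φ : ℂ → ℂ} {C : NNReal}

theorem ae_enorm_sub_le (f : LInf Ω) :
    ∀ᵐ p ∂(leb Ω).prod (leb Ω), ‖f p.1 - f p.2‖ₑ ≤ lipNorm f * ‖p.1 - p.2‖ₑ := by
  filter_upwards [enorm_ae_le_eLpNormEssSup (diffQuot f) ((leb Ω).prod (leb Ω))] with p hp
  rcases eq_or_ne p.1 p.2 with heq | hne
  · simp [heq]
  · rw [← div_mul_cancel₀ (f p.1 - f p.2) (sub_ne_zero.2 hne), enorm_mul, lipNorm,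
      eLpNorm_exponent_top]
    gcongr
    exact hp

theorem ae_norm_sub_le {f : LInf Ω} (hf : lipNorm f ≤ 1) :
    ∀ᵐ p ∂(leb Ω).prod (leb Ω), ‖f p.1 - f p.2‖ ≤ ‖p.1 - p.2‖ := by
  filter_upwards [ae_enorm_sub_le f] with p hp
  exact enorm_le_iff_norm_le.1 (hp.trans (mul_le_of_le_one_left' hf))

theorem ae_norm_diffQuot_le (hm : MemLp φ ∞ (leb Ω)) (hφ : LipschitzWith C φ) :
    ∀ᵐ p ∂(leb Ω).prod (leb Ω), ‖diffQuot (hm.toLp φ) p‖ ≤ C := by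
  filter_upwards [Measure.quasiMeasurePreserving_fst.ae hm.coeFn_toLp,
    Measure.quasiMeasurePreserving_snd.ae hm.coeFn_toLp] with p h₁ h₂
  rw [diffQuot, h₁, h₂, norm_div]
  exact div_le_of_le_mul₀ (norm_nonneg _) C.2 (hφ.norm_sub_le _ _)

theorem toLp_mem_Lam (hm : MemLp φ ∞ (leb Ω)) (hφ : LipschitzWith C φ) : hm.toLp φ ∈ Lam Ω := by
  have hfm : AEMeasurable (hm.toLp φ) (leb Ω) := (Lp.memLp _).1.aemeasurable
  refine memLp_top_of_bound (AEMeasurable.aestronglyMeasurable ?_) C (ae_norm_diffQuot_le hm hφ)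
  exact (hfm.comp_fst.sub hfm.comp_snd).div (measurable_fst.sub measurable_snd).aemeasurable

theorem lipNorm_toLp_le (hm : MemLp φ ∞ (leb Ω)) (hφ : LipschitzWith C φ) :
    lipNorm (hm.toLp φ) ≤ C := by
  rw [lipNorm, eLpNorm_exponent_top]
  simpa using eLpNormEssSup_le_of_ae_bound (ae_norm_diffQuot_le hm hφ)

theorem hsNorm_commutator_toLp_le (hm : MemLp φ ∞ (leb Ω)) (hφ : LipschitzWith 1 φ) (T : Op Ω) :
    hsNorm (mulOp (hm.toLp φ) * T - T * mulOp (hm.toLp φ)) ≤ L T :=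
  le_L T (toLp_mem_Lam hm hφ) (by exact_mod_cast lipNorm_toLp_le hm hφ)

end Lipschitz

section Exponential

theorem lipschitzWith_exp_I_mul : LipschitzWith 1 fun x : ℝ => Complex.exp (Complex.I * x) := by
  refine LipschitzWith.of_dist_le_mul fun x y => ?_
  have factor : Complex.exp (Complex.I * x) - Complex.exp (Complex.I * y)
      = Complex.exp (y * Complex.I) * (Complex.exp (Complex.I * (x - y : ℝ)) - 1) := by
    rw [mul_sub, ← Complex.exp_add, mul_one, mul_comm _ Complex.I, ← mul_add, ← Complex.ofReal_add,
      add_sub_cancel]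
  rw [dist_eq_norm, dist_eq_norm, factor, norm_mul, Complex.norm_exp_ofReal_mul_I, NNReal.coe_one]
  gcongr
  exact Real.norm_exp_I_mul_ofReal_sub_one_le

theorem lipschitzWith_exp_I_mul_re (w : ℂ) :
    LipschitzWith ‖w‖₊ fun z : ℂ => Complex.exp (Complex.I * ((z * conj w).re : ℂ)) := by
  refine LipschitzWith.of_dist_le_mul fun s t => ?_
  calc _ ≤ dist (s * conj w).re (t * conj w).re := by
        simpa using lipschitzWith_exp_I_mul.dist_le_mul (s * conj w).re (t * conj w).re
    _ ≤ ‖w‖₊ * dist s t := by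
        rw [dist_eq_norm, dist_eq_norm, ← Complex.sub_re, ← sub_mul, coe_nnnorm,
          ← RCLike.norm_conj w, mul_comm, ← norm_mul]
        exact Complex.abs_re_le_norm _

theorem norm_exp_sub_exp_sub_le {R x y : ℝ} (hx : |x| ≤ R) (hy : |y| ≤ R) :
    ‖Complex.exp (Complex.I * x) - Complex.exp (Complex.I * y) - Complex.I * (x - y)‖
      ≤ R * |x - y| := by
  let h (u : ℝ) : ℂ := Complex.exp (Complex.I * u) - Complex.I * u
  have h_deriv (u : ℝ) :
      HasDerivAt h (Complex.I * (Complex.exp (Complex.I * u) - 1)) u := by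
    have I_mul_deriv : HasDerivAt (fun v : ℝ => Complex.I * v) Complex.I u := by
      simpa using (Complex.ofRealCLM.hasDerivAt (x := u)).const_mul Complex.I
    exact (I_mul_deriv.cexp.sub I_mul_deriv).congr_deriv (by ring)
  have h_deriv_le (u : ℝ) (hu : u ∈ Set.Icc (-R) R) :
      ‖Complex.I * (Complex.exp (Complex.I * u) - 1)‖ ≤ R := by
    rw [norm_mul, Complex.norm_I, one_mul]
    exact Real.norm_exp_I_mul_ofReal_sub_one_le.trans (abs_le.2 hu)
  have h_sub_le : ‖h x - h y‖ ≤ R * ‖x - y‖ :=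
    (convex_Icc (-R) R).norm_image_sub_le_of_norm_hasDerivWithin_le
      (fun u _ => (h_deriv u).hasDerivWithinAt) h_deriv_le (abs_le.1 hy) (abs_le.1 hx)
  calc _ = ‖h x - h y‖ := by
        simp only [h]
        ring_nf
    _ ≤ _ := h_sub_le

/-- The difference quotient `((e^{itx} - 1) + i (e^{ity} - 1)) / (it)`, up to an additive constant;
it approximates the coordinate function `z = x + iy` for small `t`. -/
def coordSlope (t : ℝ) (z : ℂ) : ℂ :=
  (Complex.I * t)⁻¹ * (Complex.exp (Complex.I * (t * z.re : ℝ))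
    + Complex.I * Complex.exp (Complex.I * (t * z.im : ℝ)))

theorem norm_coordSlope_sub_sub_le {t R : ℝ} (ht : 0 < t) {s s' : ℂ} (hs : ‖s‖ ≤ R)
    (hs' : ‖s'‖ ≤ R) :
    ‖coordSlope t s - coordSlope t s' - (s - s')‖ ≤ 2 * (t * R) * ‖s - s'‖ := by
  let E (x y : ℝ) : ℂ :=
    Complex.exp (Complex.I * x) - Complex.exp (Complex.I * y) - Complex.I * (x - y)
  have E_le {x y : ℝ} (hx : |x| ≤ R) (hy : |y| ≤ R) :
      ‖E (t * x) (t * y)‖ ≤ t * R * (t * |x - y|) := by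
    have scaled {u : ℝ} (hu : |u| ≤ R) : |t * u| ≤ t * R := by
      rw [abs_mul, abs_of_pos ht]
      gcongr
    refine (norm_exp_sub_exp_sub_le (scaled hx) (scaled hy)).trans_eq ?_
    rw [← mul_sub, abs_mul, abs_of_pos ht]
  have t_ne_zero : (t : ℂ) ≠ 0 := mod_cast ht.ne'
  have slope_eq : coordSlope t s - coordSlope t s' - (s - s') = (Complex.I * t)⁻¹ *
      (E (t * s.re) (t * s'.re) + Complex.I * E (t * s.im) (t * s'.im)) := by
    have sub_eq : s - s' = (s.re - s'.re) + (s.im - s'.im) * Complex.I := by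
      apply Complex.ext <;> simp
    rw [sub_eq]
    simp only [coordSlope, E]
    push_cast
    field_simp
    ring
  rw [slope_eq, norm_mul, norm_inv, norm_mul, Complex.norm_I, one_mul,
    Complex.norm_of_nonneg ht.le, inv_mul_le_iff₀ ht]
  calc _ ≤ ‖E (t * s.re) (t * s'.re)‖ + ‖E (t * s.im) (t * s'.im)‖ := by
        refine (norm_add_le _ _).trans_eq ?_
        rw [norm_mul, Complex.norm_I, one_mul]
    _ ≤ t * R * (t * |s.re - s'.re|) + t * R * (t * |s.im - s'.im|) := by
        gcongr
        · exact E_le ((Complex.abs_re_le_norm s).trans hs) ((Complex.abs_re_le_norm s').trans hs')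
        · exact E_le ((Complex.abs_im_le_norm s).trans hs) ((Complex.abs_im_le_norm s').trans hs')
    _ ≤ t * R * (t * ‖s - s'‖) + t * R * (t * ‖s - s'‖) := by
        have : 0 ≤ R := (norm_nonneg s).trans hs
        gcongr
        · exact Complex.abs_re_le_norm (s - s')
        · exact Complex.abs_im_le_norm (s - s')
    _ = t * (2 * (t * R) * ‖s - s'‖) := by ring

end Exponential

section Comparison

variable {Ω : Set ℂ}

theorem inv_enorm_mul_hsNorm {H : Type*} [NormedAddCommGroup H] [InnerProductSpace ℂ H]
    [CompleteSpace H] {w : ℂ} (hw : w ≠ 0) (X : H →L[ℂ] H) :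
    ‖w‖ₑ⁻¹ * hsNorm X = hsNorm (((‖w‖ : ℂ))⁻¹ • X) := by
  rw [hsNorm_smul, enorm_inv (by simpa using hw)]
  simp [← ofReal_norm]

theorem L₁_le_L (T : Op Ω) : L₁ T ≤ L T := by
  refine iSup₂_le fun w hw => ?_
  have scaled_lipschitz : LipschitzWith 1 fun z : ℂ =>
      ((‖w‖ : ℂ))⁻¹ • Complex.exp (Complex.I * ((z * conj w).re : ℂ)) := by
    have lipschitz := (lipschitzWith_smul ((‖w‖ : ℂ))⁻¹).comp (lipschitzWith_exp_I_mul_re w)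
    have constant_eq : ‖((‖w‖ : ℂ))⁻¹‖₊ * ‖w‖₊ = 1 := by
      rw [nnnorm_inv, Complex.nnnorm_real, nnnorm_norm, inv_mul_cancel₀ (nnnorm_ne_zero_iff.2 hw)]
    exact constant_eq ▸ lipschitz
  have commutator_le :=
    hsNorm_commutator_toLp_le ((memLp_e Ω w).const_smul ((‖w‖ : ℂ))⁻¹) scaled_lipschitz T
  have mulOp_eq : mulOp (((memLp_e Ω w).const_smul ((‖w‖ : ℂ))⁻¹).toLp _)
      = ((‖w‖ : ℂ))⁻¹ • U Ω w := map_smul (mulL (leb Ω)) _ (e Ω w)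
  rwa [mulOp_eq, smul_mul_assoc, mul_smul_comm, ← smul_sub, ← inv_enorm_mul_hsNorm hw,
    hsNorm_sub_comm] at commutator_le

theorem le_L₁ (T : Op Ω) {w : ℂ} (hw : w ≠ 0) :
    ‖w‖ₑ⁻¹ * hsNorm (T * U Ω w - U Ω w * T) ≤ L₁ T :=
  le_iSup₂_of_le w hw le_rfl

variable (Ω) in
/-- The function `coordSlope t` as an element of `L^∞(Ω, λ)`, written as a combination of the
symbols of `U(t)` and `U(it)`. -/
def coordSlopeSymbol (t : ℝ) : LInf Ω :=
  (Complex.I * t : ℂ)⁻¹ • (e Ω t + Complex.I • e Ω (Complex.I * t))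

theorem coordSlopeSymbol_coeFn (t : ℝ) : coordSlopeSymbol Ω t =ᵐ[leb Ω] coordSlope t := by
  filter_upwards [Lp.coeFn_smul (Complex.I * t : ℂ)⁻¹ (e Ω t + Complex.I • e Ω (Complex.I * t)),
    Lp.coeFn_add (e Ω t) (Complex.I • e Ω (Complex.I * t)),
    Lp.coeFn_smul Complex.I (e Ω (Complex.I * t)), (memLp_e Ω t).coeFn_toLp,
    (memLp_e Ω (Complex.I * t)).coeFn_toLp] with z h₁ h₂ h₃ h₄ h₅
  rw [coordSlopeSymbol, h₁, Pi.smul_apply, h₂, Pi.add_apply, h₃, Pi.smul_apply, e, h₄, e, h₅,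
    coordSlope]
  simp [mul_comm]

theorem hsNorm_commutator_coordSlopeSymbol_le (T : Op Ω) {t : ℝ} (ht : 0 < t) :
    hsNorm (mulOp (coordSlopeSymbol Ω t) * T - T * mulOp (coordSlopeSymbol Ω t)) ≤ 2 * L₁ T := by
  have t_ne_zero : (t : ℂ) ≠ 0 := mod_cast ht.ne'
  have mulOp_eq : mulOp (coordSlopeSymbol Ω t)
      = (Complex.I * t : ℂ)⁻¹ • (U Ω t + Complex.I • U Ω (Complex.I * t)) := by
    change mulL (leb Ω) _ = _
    rw [coordSlopeSymbol, map_smul, map_add, map_smul]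
    rfl
  have commutator_eq : mulOp (coordSlopeSymbol Ω t) * T - T * mulOp (coordSlopeSymbol Ω t)
      = (Complex.I * t : ℂ)⁻¹ • ((U Ω t * T - T * U Ω t)
        + Complex.I • (U Ω (Complex.I * t) * T - T * U Ω (Complex.I * t))) := by
    rw [mulOp_eq]
    simp only [smul_mul_assoc, mul_smul_comm, add_mul, mul_add, smul_add, smul_sub]
    abel
  have enorm_I_mul : ‖(Complex.I * t : ℂ)‖ₑ = ‖(t : ℂ)‖ₑ := by
    simp [← ofReal_norm]
  calc _ ≤ ‖(t : ℂ)‖ₑ⁻¹ * (hsNorm (U Ω t * T - T * U Ω t)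
        + hsNorm (U Ω (Complex.I * t) * T - T * U Ω (Complex.I * t))) := by
        rw [commutator_eq, hsNorm_smul, enorm_inv (mul_ne_zero Complex.I_ne_zero t_ne_zero),
          enorm_I_mul]
        gcongr
        refine (hsNorm_triangle _ _).trans_eq ?_
        rw [hsNorm_smul]
        simp [← ofReal_norm]
    _ ≤ L₁ T + L₁ T := by
        rw [mul_add]
        gcongr
        · rw [hsNorm_sub_comm]
          exact le_L₁ T t_ne_zero
        · rw [← enorm_I_mul, hsNorm_sub_comm]
          exact le_L₁ T (mul_ne_zero Complex.I_ne_zero t_ne_zero)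
    _ = 2 * L₁ T := (two_mul _).symm

theorem hsNorm_cutCommutator_closedBall_le {f : LInf Ω} (hf : lipNorm f ≤ 1) (T : Op Ω)
    {R : ℝ} (hR : 0 ≤ R) :
    hsNorm (cutCommutator (measurableSet_closedBall (x := (0 : ℂ)) (ε := R)) f T)
      ≤ 2 * L₁ T := by
  have error_tendsto : Tendsto (fun t : ℝ => 2 * (t * R)) (𝓝[>] 0) (𝓝 0) :=
    tendsto_nhdsWithin_of_tendsto_nhds (Continuous.tendsto' (by fun_prop) _ _ (by simp))
  have constant_tendsto : Tendsto (fun t : ℝ => ENNReal.ofReal (1 - 2 * (t * R))⁻¹ * (2 * L₁ T))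
      (𝓝[>] 0) (𝓝 (2 * L₁ T)) := by
    have inv_tendsto := (error_tendsto.const_sub 1).inv₀ (by simp)
    simpa using ENNReal.Tendsto.mul_const (b := 2 * L₁ T) (ENNReal.tendsto_ofReal inv_tendsto)
      (.inl (by simp))
  refine ge_of_tendsto constant_tendsto ?_
  filter_upwards [self_mem_nhdsWithin, error_tendsto.eventually_lt_const one_pos] with t ht ht₁
  rw [Set.mem_Ioi] at ht
  refine (hsNorm_cutCommutator_le_of_norm_sub_sub_le measurableSet_closedBall
    Metric.isBounded_closedBall (ψ := coordSlopeSymbol Ω t) (by positivity) ht₁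
    (ae_norm_sub_le hf) ?_).trans ?_
  · filter_upwards [Measure.quasiMeasurePreserving_fst.ae (coordSlopeSymbol_coeFn t),
      Measure.quasiMeasurePreserving_snd.ae (coordSlopeSymbol_coeFn t)] with p h₁ h₂ hp₁ hp₂
    rw [h₁, h₂]
    exact norm_coordSlope_sub_sub_le ht (mem_closedBall_zero_iff.1 hp₁)
      (mem_closedBall_zero_iff.1 hp₂)
  · gcongr
    exact (hsNorm_cutCommutator_le_hsNorm _ _ _).trans (hsNorm_commutator_coordSlopeSymbol_le T ht)

theorem L_le_two_mul_L₁ (T : Op Ω) : L T ≤ 2 * L₁ T := by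
  refine iSup₂_le fun f _ => iSup_le fun hf => ?_
  refine hsNorm_le_of_forall_cutoff (B := fun n : ℕ => Metric.closedBall 0 n)
    (fun _ => measurableSet_closedBall) (.of_forall fun z => ?_)
    fun n => hsNorm_cutCommutator_closedBall_le hf T n.cast_nonneg
  filter_upwards [tendsto_natCast_atTop_atTop.eventually_ge_atTop ‖z‖] with n hn
  exact mem_closedBall_zero_iff.2 hn

theorem L_eq_hsNorm_commutator_Z (hΩ : MeasurableSet Ω) (hb : Bornology.IsBounded Ω) (T : Op Ω) :
    L T = hsNorm (T * Z hΩ hb - Z hΩ hb * T) := by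
  rw [hsNorm_sub_comm]
  refine le_antisymm (iSup₂_le fun f _ => iSup_le fun hf => ?_)
    (hsNorm_commutator_toLp_le (memLp_id hΩ hb) LipschitzWith.id T)
  have cutCommutator_eq (φ : LInf Ω) : cutCommutator hΩ φ T = mulOp φ * T - T * mulOp φ := by
    rw [cutCommutator, cutoff_eq_one hΩ (ae_restrict_mem hΩ), one_mul, mul_one]
    rfl
  have commutator_le := hsNorm_cutCommutator_le_of_norm_sub_sub_le (T := T) (ε := 0)
    (ψ := (memLp_id hΩ hb).toLp _) hΩ hb le_rfl one_pos (ae_norm_sub_le hf) (by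
      filter_upwards [Measure.quasiMeasurePreserving_fst.ae (memLp_id hΩ hb).coeFn_toLp,
        Measure.quasiMeasurePreserving_snd.ae (memLp_id hΩ hb).coeFn_toLp] with p h₁ h₂ _ _
      simp [h₁, h₂])
  simpa [cutCommutator_eq, Z] using commutator_le

end Comparison

section Norm

variable {Ω : Set ℂ}

theorem L₁_add_le (S T : Op Ω) : L₁ (S + T) ≤ L₁ S + L₁ T := by
  refine iSup₂_le fun w hw => ?_
  have commutator_add : (S + T) * U Ω w - U Ω w * (S + T)
      = (S * U Ω w - U Ω w * S) + (T * U Ω w - U Ω w * T) := by noncomm_ring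
  calc _ ≤ ‖w‖ₑ⁻¹ * (hsNorm (S * U Ω w - U Ω w * S) + hsNorm (T * U Ω w - U Ω w * T)) := by
        rw [commutator_add]
        gcongr
        exact hsNorm_triangle _ _
    _ ≤ L₁ S + L₁ T := by
        rw [mul_add]
        exact add_le_add (le_L₁ S hw) (le_L₁ T hw)

theorem L₁_smul (c : ℂ) (T : Op Ω) : L₁ (c • T) = ‖c‖ₑ * L₁ T := by
  simp only [L₁, ENNReal.mul_iSup]
  refine iSup_congr fun w => iSup_congr fun _ => ?_
  rw [smul_mul_assoc, mul_smul_comm, ← smul_sub, hsNorm_smul, mul_left_comm]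

theorem L₁_zero : L₁ (0 : Op Ω) = 0 := by
  simpa using L₁_smul 0 (0 : Op Ω)

theorem L₁_neg (T : Op Ω) : L₁ (-T) = L₁ T := by
  simpa using L₁_smul (-1) T

theorem L₁_mul_le (S T : Op Ω) : L₁ (S * T) ≤ L₁ S * ‖T‖ₑ + ‖S‖ₑ * L₁ T := by
  refine iSup₂_le fun w hw => ?_
  have leibniz : (S * T) * U Ω w - U Ω w * (S * T)
      = (S * U Ω w - U Ω w * S) * T + S * (T * U Ω w - U Ω w * T) := by noncomm_ring
  calc _ ≤ ‖w‖ₑ⁻¹ * (hsNorm (S * U Ω w - U Ω w * S) * ‖T‖ₑ +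
          ‖S‖ₑ * hsNorm (T * U Ω w - U Ω w * T)) := by
        rw [leibniz]
        gcongr
        exact (hsNorm_triangle _ _).trans (add_le_add (hsNorm_mul_le' _ _) (hsNorm_mul_le _ _))
    _ = (‖w‖ₑ⁻¹ * hsNorm (S * U Ω w - U Ω w * S)) * ‖T‖ₑ +
          ‖S‖ₑ * (‖w‖ₑ⁻¹ * hsNorm (T * U Ω w - U Ω w * T)) := by ring
    _ ≤ L₁ S * ‖T‖ₑ + ‖S‖ₑ * L₁ T := by gcongr <;> exact le_L₁ _ hw

theorem L₁_le_of_tendsto {ι : Type*} {l : Filter ι} [l.NeBot] {A : ι → Op Ω} {B : Op Ω}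
    {C : ℝ≥0∞} (h : Tendsto A l (𝓝 B)) (hC : ∀ᶠ n in l, L₁ (A n) ≤ C) : L₁ B ≤ C := by
  refine iSup₂_le fun w hw => ?_
  rw [inv_enorm_mul_hsNorm hw]
  refine hsNorm_le_of_tendsto (l := l)
    (A := fun n => ((‖w‖ : ℂ))⁻¹ • (A n * U Ω w - U Ω w * A n)) (fun x => ?_) ?_
  · have commutator_tendsto := ((h.mul_const (U Ω w)).sub (h.const_mul (U Ω w))).const_smul
      ((‖w‖ : ℂ))⁻¹
    exact ((ContinuousLinearMap.apply ℂ (L2 Ω) x).continuous.tendsto _).comp commutator_tendsto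
  · filter_upwards [hC] with n hn
    rw [← inv_enorm_mul_hsNorm hw]
    exact (le_L₁ _ hw).trans hn

theorem mem_EΛ_iff_L₁_ne_top {T : Op Ω} : T ∈ EΛ Ω ↔ L₁ T ≠ ∞ := by
  refine ⟨fun h => ((L₁_le_L T).trans_lt h).ne, fun h => ?_⟩
  exact (L_le_two_mul_L₁ T).trans_lt (ENNReal.mul_lt_top ENNReal.ofNat_lt_top h.lt_top)

theorem L₁_ne_top (T : EΛ Ω) : L₁ (T : Op Ω) ≠ ∞ := mem_EΛ_iff_L₁_ne_top.1 T.2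

theorem triNorm₁_zero : triNorm₁ (0 : EΛ Ω) = 0 := by
  simp [triNorm₁, L₁_zero]

theorem triNorm₁_neg (T : EΛ Ω) : triNorm₁ (-T) = triNorm₁ T := by
  simp [triNorm₁, L₁_neg]

theorem triNorm₁_smul (c : ℂ) (T : EΛ Ω) : triNorm₁ (c • T) = ‖c‖ * triNorm₁ T := by
  simp only [triNorm₁, Subalgebra.coe_smul, L₁_smul, norm_smul, ENNReal.toReal_mul, toReal_enorm]
  ring

theorem triNorm₁_add_le (S T : EΛ Ω) : triNorm₁ (S + T) ≤ triNorm₁ S + triNorm₁ T := by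
  have L₁_le := ENNReal.toReal_mono (ENNReal.add_ne_top.2 ⟨L₁_ne_top S, L₁_ne_top T⟩)
    (L₁_add_le (S : Op Ω) T)
  rw [ENNReal.toReal_add (L₁_ne_top S) (L₁_ne_top T)] at L₁_le
  simp only [triNorm₁, Subalgebra.coe_add]
  linarith [norm_add_le (S : Op Ω) T]

theorem triNorm₁_mul_le (S T : EΛ Ω) : triNorm₁ (S * T) ≤ triNorm₁ S * triNorm₁ T := by
  have left_ne_top := ENNReal.mul_ne_top (L₁_ne_top S) (enorm_ne_top (x := (T : Op Ω)))
  have right_ne_top := ENNReal.mul_ne_top (enorm_ne_top (x := (S : Op Ω))) (L₁_ne_top T)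
  have L₁_le := ENNReal.toReal_mono (ENNReal.add_ne_top.2 ⟨left_ne_top, right_ne_top⟩)
    (L₁_mul_le (S : Op Ω) T)
  rw [ENNReal.toReal_add left_ne_top right_ne_top, ENNReal.toReal_mul, ENNReal.toReal_mul,
    toReal_enorm, toReal_enorm] at L₁_le
  have product_nonneg : 0 ≤ (L₁ (S : Op Ω)).toReal * (L₁ (T : Op Ω)).toReal := by positivity
  simp only [triNorm₁, Subalgebra.coe_mul]
  linarith [norm_mul_le (S : Op Ω) T]

theorem norm_le_triNorm₁ (T : EΛ Ω) : ‖(T : Op Ω)‖ ≤ triNorm₁ T :=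
  le_add_of_nonneg_right ENNReal.toReal_nonneg

theorem L₁_le_ofReal_triNorm₁ (T : EΛ Ω) : L₁ (T : Op Ω) ≤ ENNReal.ofReal (triNorm₁ T) := by
  rw [← ENNReal.ofReal_toReal (L₁_ne_top T)]
  exact ENNReal.ofReal_le_ofReal (le_add_of_nonneg_left (norm_nonneg _))

variable (Ω) in
/-- The norm `|||·|||₁` as a bundled algebra norm on `EΛ(Ω)`. -/
def algebraNorm₁ : AlgebraNorm ℂ (EΛ Ω) where
  toFun := triNorm₁
  map_zero' := triNorm₁_zero
  add_le' := triNorm₁_add_le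
  neg' := triNorm₁_neg
  mul_le' := triNorm₁_mul_le
  smul' := triNorm₁_smul
  eq_zero_of_map_eq_zero' T hT :=
    Subtype.ext (norm_le_zero_iff.1 ((norm_le_triNorm₁ T).trans_eq hT))

theorem L₁_sub_le_of_tendsto {u : ℕ → EΛ Ω} {T : Op Ω}
    (hT : Tendsto (fun n => (u n : Op Ω)) atTop (𝓝 T)) {ε : ℝ} {N : ℕ}
    (hN : ∀ m ≥ N, ∀ n ≥ N, triNorm₁ (u m - u n) < ε) {n : ℕ} (hn : N ≤ n) :
    L₁ ((u n : Op Ω) - T) ≤ ENNReal.ofReal ε := by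
  refine L₁_le_of_tendsto (hT.const_sub (u n : Op Ω)) ?_
  filter_upwards [eventually_ge_atTop N] with m hm
  exact (L₁_le_ofReal_triNorm₁ (u n - u m)).trans (ENNReal.ofReal_le_ofReal (hN n hn m hm).le)

theorem exists_triNorm₁_limit {u : ℕ → EΛ Ω}
    (hu : ∀ ε > 0, ∃ N, ∀ m ≥ N, ∀ n ≥ N, triNorm₁ (u m - u n) < ε) :
    ∃ T : EΛ Ω, ∀ ε > 0, ∃ N, ∀ n ≥ N, triNorm₁ (u n - T) < ε := by
  have u_cauchy : CauchySeq (fun n => (u n : Op Ω)) := by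
    refine Metric.cauchySeq_iff.2 fun ε hε => ?_
    obtain ⟨N, hN⟩ := hu ε hε
    refine ⟨N, fun m hm n hn => ?_⟩
    rw [dist_eq_norm]
    exact (norm_le_triNorm₁ (u m - u n)).trans_lt (hN m hm n hn)
  obtain ⟨T, hT⟩ := cauchySeq_tendsto_of_complete u_cauchy
  have T_mem : T ∈ EΛ Ω := by
    obtain ⟨N, hN⟩ := hu 1 one_pos
    have sub_mem : (u N : Op Ω) - T ∈ EΛ Ω := mem_EΛ_iff_L₁_ne_top.2
      (ne_top_of_le_ne_top ENNReal.ofReal_ne_top (L₁_sub_le_of_tendsto hT hN le_rfl))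
    simpa using (EΛ Ω).sub_mem (u N).2 sub_mem
  refine ⟨⟨T, T_mem⟩, fun ε hε => ?_⟩
  obtain ⟨N₁, hN₁⟩ := hu (ε / 2) (by positivity)
  obtain ⟨N₂, hN₂⟩ := Metric.tendsto_atTop.1 hT (ε / 2) (by positivity)
  refine ⟨max N₁ N₂, fun n hn => ?_⟩
  have L₁_le : (L₁ ((u n : Op Ω) - T)).toReal ≤ ε / 2 := ENNReal.toReal_le_of_le_ofReal
    (by positivity) (L₁_sub_le_of_tendsto hT hN₁ ((le_max_left _ _).trans hn))
  have norm_lt : ‖(u n : Op Ω) - T‖ < ε / 2 := by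
    rw [← dist_eq_norm]
    exact hN₂ n ((le_max_right _ _).trans hn)
  simp only [triNorm₁, Subalgebra.coe_sub]
  linarith

theorem completeSpace_of_ringNorm {A : Type*} [Ring A] (p : RingNorm A)
    (h : ∀ u : ℕ → A, (∀ ε > 0, ∃ N, ∀ m ≥ N, ∀ n ≥ N, p (u m - u n) < ε) →
      ∃ x, ∀ ε > 0, ∃ N, ∀ n ≥ N, p (u n - x) < ε) :
    @CompleteSpace A p.toNormedRing.toMetricSpace.toUniformSpace := by
  let _ : NormedRing A := p.toNormedRing
  have dist_eq (x y : A) : dist x y = p (x - y) := dist_eq_norm x y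
  refine Metric.complete_of_cauchySeq_tendsto fun u hu => ?_
  rw [Metric.cauchySeq_iff] at hu
  simp only [Metric.tendsto_atTop, dist_eq] at hu ⊢
  exact h u hu

theorem isBanachAlgebraNorm_triNorm₁ : IsBanachAlgebraNorm (triNorm₁ (Ω := Ω)) :=
  ⟨algebraNorm₁ Ω, fun _ => rfl,
    completeSpace_of_ringNorm (algebraNorm₁ Ω).toRingNorm fun _ hu => exists_triNorm₁_limit hu⟩

theorem normEquivalent_triNorm : NormEquivalent (triNorm (Ω := Ω)) (triNorm₁ (Ω := Ω)) := by
  refine ⟨1 / 2, 1, by norm_num, one_pos, fun T => ?_⟩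
  have L₁_le := ENNReal.toReal_mono T.2.ne (L₁_le_L (T : Op Ω))
  have L_le := ENNReal.toReal_mono (ENNReal.mul_ne_top ENNReal.ofNat_ne_top (L₁_ne_top T))
    (L_le_two_mul_L₁ (T : Op Ω))
  rw [ENNReal.toReal_mul, ENNReal.toReal_ofNat] at L_le
  have norm_T_nonneg := norm_nonneg (T : Op Ω)
  simp only [triNorm, triNorm₁]
  constructor <;> linarith

end Norm

end

end ELam

theorem mainTheorem10 (Ω : Set ℂ) (hΩ : MeasurableSet Ω) :
    (∀ T : ELam.Op Ω, ELam.L₁ T ≤ ELam.L T ∧ ELam.L T ≤ 2 * ELam.L₁ T) ∧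
    ELam.IsBanachAlgebraNorm (ELam.triNorm₁ (Ω := Ω)) ∧
    ELam.NormEquivalent (ELam.triNorm (Ω := Ω)) (ELam.triNorm₁ (Ω := Ω)) ∧
    (∀ (hb : Bornology.IsBounded Ω) (T : ELam.Op Ω),
      ELam.L T = ELam.hsNorm (T * ELam.Z hΩ hb - ELam.Z hΩ hb * T)) :=
  ⟨fun T => ⟨ELam.L₁_le_L T, ELam.L_le_two_mul_L₁ T⟩, ELam.isBanachAlgebraNorm_triNorm₁,
    ELam.normEquivalent_triNorm, fun hb T => ELam.L_eq_hsNorm_commutator_Z hΩ hb T⟩
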